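/- **Setting (MB-OSM).** Let $G=(I,J,E)$ be a finite bipartite graph of offline agents $I$ and online agents $J$, with $K$ resources having budgets $B_k\in\mathbb{Z}^+$, and let $B=\min_k B_k$. Each edge $e\in E$ has a random cost $\mathcal{A}_e=(A_{e,k})_k\in\{0,1\}^K$ and a random utility $W_e\ge 0$ (possibly correlated with $\mathcal{A}_e$) with finite mean $w_e$; put $a_{e,k}=\mathbb{E}[A_{e,k}]$ and $\mathcal{S}_e=\{k: a_{e,k}>0\}$, and assume $|\mathcal{S}_e|\le\Delta$ for all $e$ ($\Delta$ is the sparsity). In each of $T$ rounds one online agent arrives, independently, $j$ being drawn with known probability $p_j$, $\sum_j p_j=1$; put $r_j=Tp_j$. On an arrival of $j$ one must immediately reject it or add an edge $e\in E$ incident to $j$; adding $e$ draws a fresh realization of $(\mathcal{A}_e,W_e)$, independent of everything before, which is then observed, consumed and earned. All policies are *safe*: $e$ may be added only if every resource in $\mathcal{S}_e$ has at least one unit of budget left. The distributions are known; policies may be randomized. A clairvoyant optimum $\mathrm{OPT}$ is a best safe policy that knows the whole arrival sequence in advance (but not the realizations of edges not yet added). The benchmark LP is $$\max\ \sum_{e\in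 E} w_e x_e\quad\text{s.t.}\quad \sum_{e\ni j}x_e\le r_j\ (j\in J),\quad \sum_{e\in E}a_{e,k}x_e\le B_k\ (k\in[K]),\quad x_e\ge 0\ (e\in E).$$ Algorithm $\mathrm{SAMP}(1)$ takes an optimal solution $x^*$ of this LP; when $j$ arrives it samples at most one edge, each edge $e$ incident to $j$ with probability $x_e^*/r_j$, and adds the sampled edge if it is safe, rejecting $j$ otherwise. An algorithm achieves the competitive ratio $\rho\in[0,1]$ against a benchmark (the LP value, or the expected utility of $\mathrm{OPT}$) on the class of all instances with horizon $T$, sparsity at most $\Delta$ and minimum budget $B$ if on each of them its expected total utility is at least $\rho$ times the benchmark. **Theorem 4.** (i) For $\Delta=1$, as $B\to\infty$ and $T/B\to\infty$: the largest competitive ratio that $\mathrm{SAMP}(1)$ achieves against the LP (for every choice of the optimal solution $x^*$) is $1-\frac{1}{\sqrt{2\pi B}}(1+o(1))$, and $\mathrm{SAMP}(1)$ achieves this ratio also against $\mathrm{OPT}$. (ii) There is a constant $\kappa$ with $\sqrt2\le\kappa\le 2\sqrt2$ such that, as $\ln\Delta\to\infty$, $B/\ln\Delta\to\infty$ and $T/B\to\infty$: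 the largest competitive ratio that $\mathrm{SAMP}(1)$ achieves against the LP (for every choice of $x^*$) is $1-\kappa\sqrt{\frac{\ln\Delta}{B}}\,(1+o(1))$, and $\mathrm{SAMP}(1)$ achieves this ratio also against $\mathrm{OPT}$. Both ratios are asymptotically optimal against the LP: the supremum of the competitive ratios that online algorithms achieve against the LP is $1-\frac{1}{\sqrt{2\pi B}}(1+o(1))$ in case (i), and $1-\kappa\sqrt{\frac{\ln\Delta}{B}}\,(1+o(1))$, with the same $\kappa$, in case (ii). -/

import Mathlib

open MeasureTheory ProbabilityTheory Filter Topology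
open scoped ENNReal NNReal

noncomputable section

/-- An instance of multi-budgeted online stochastic matching under known i.i.d. arrivals. -/
structure MBOSM where
  /-- number of offline agents -/
  nI : ℕ
  /-- number of online agents (types) -/
  nJ : ℕ
  /-- number of resources -/
  K : ℕ
  /-- time horizon (number of rounds) -/
  T : ℕ
  /-- edges of the bipartite graph -/
  E : Finset (Fin nI × Fin nJ)
  /-- budgets, which are positive integers -/
  budget : Fin K → ℕ
  budget_pos : ∀ k, 0 < budget k
  /-- arrival distribution of each round -/
  p : Fin nJ → ℝ≥0
  p_sum : ∑ j, p j = 1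
  /-- joint law of the random cost vector in `{0,1}^K` and of the nonnegative random utility of an
  edge; the two may be correlated in an arbitrary way -/
  law : E → Measure ((Fin K → Bool) × ℝ≥0)
  law_prob : ∀ e, IsProbabilityMeasure (law e)
  /-- expected utilities are finite -/
  util_finite : ∀ e, ∫⁻ z, (z.2 : ℝ≥0∞) ∂(law e) ≠ ∞

namespace MBOSM

variable (I : MBOSM)

/-- The type of edges. -/
abbrev Edge : Type := {e : Fin I.nI × Fin I.nJ // e ∈ I.E}

/-- The decision taken in a round: `none` (reject) or `some e` (add the edge `e`). -/
def Decision : Type := Option I.Edge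

instance : Fintype I.Decision := inferInstanceAs (Fintype (Option I.Edge))

instance : MeasurableSpace I.Decision := ⊤

instance : DiscreteMeasurableSpace I.Decision := ⟨fun _ => trivial⟩

/-- What is observed in a round: the decision, the realized cost vector, the realized utility. -/
abbrev Outcome : Type := I.Decision × ((Fin I.K → Bool) × ℝ≥0)

/-- Arrival rate `r_j = T p_j`. -/
def rate (j : Fin I.nJ) : ℝ := I.T * I.p j

/-- `a_{e,k} = E[A_{e,k}]`, the probability that adding `e` consumes a unit of resource `k`. -/
def meanCost (e : I.Edge) (k : Fin I.K) : ℝ := (I.law e).real {z | z.1 k = true}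

/-- `w_e = E[W_e]`. -/
def meanUtil (e : I.Edge) : ℝ := (∫⁻ z, (z.2 : ℝ≥0∞) ∂(I.law e)).toReal

open Classical in
/-- `S_e`, the set of resources that the edge `e` may consume. -/
def support (e : I.Edge) : Finset (Fin I.K) := Finset.univ.filter fun k => 0 < I.meanCost e k

/-- Number of units of resource `k` consumed in a history of `t` rounds. -/
def consumed {t : ℕ} (h : Fin t → I.Outcome) (k : Fin I.K) : ℕ :=
  (Finset.univ.filter fun s => (h s).2.1 k = true).card

/-- The edge `e` is safe after the history `h`: every resource in `S_e` has at least one unit of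
remaining budget. -/
def Safe {t : ℕ} (h : Fin t → I.Outcome) (e : I.Edge) : Prop :=
  ∀ k ∈ I.support e, I.consumed h k + 1 ≤ I.budget k

open Classical in
/-- Number of edges incident to the online agent `j` that were added in the history `h`. -/
def matched {t : ℕ} (h : Fin t → I.Outcome) (j : Fin I.nJ) : ℕ :=
  (Finset.univ.filter fun s => ∃ e : I.Edge, (h s).1 = some e ∧ e.1.2 = j).card

/-- Law of the realized cost and utility, given the decision; a rejection costs and yields nothing.
Every addition of an edge draws a fresh independent realization. -/
def realizationLaw : I.Decision → Measure ((Fin I.K → Bool) × ℝ≥0)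
  | none => Measure.dirac (fun _ => false, 0)
  | some e => I.law e

instance (d : I.Decision) : IsProbabilityMeasure (I.realizationLaw d) := by
  cases d with
  | none => exact inferInstanceAs (IsProbabilityMeasure (Measure.dirac _))
  | some e => exact I.law_prob e

/-! ### The benchmark linear program -/

/-- Feasible solutions of the benchmark LP. -/
structure LPFeasible (x : I.Edge → ℝ) : Prop where
  nonneg : ∀ e, 0 ≤ x e
  arrival : ∀ j, ∑ e : I.Edge with e.1.2 = j, x e ≤ I.rate j
  budget : ∀ k, ∑ e, I.meanCost e k * x e ≤ I.budget k

/-- Objective of the benchmark LP. -/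
def lpObjective (x : I.Edge → ℝ) : ℝ := ∑ e, I.meanUtil e * x e

/-- Optimal solutions of the benchmark LP. -/
def LPOptimal (x : I.Edge → ℝ) : Prop :=
  I.LPFeasible x ∧ ∀ y, I.LPFeasible y → I.lpObjective y ≤ I.lpObjective x

/-- Optimal value of the benchmark LP. -/
def lpValue : ℝ≥0∞ := ⨆ (x : I.Edge → ℝ) (_ : I.LPFeasible x), ENNReal.ofReal (I.lpObjective x)

/-! ### Policies -/

/-- A safe randomized policy. `prob a t ht h d` is the probability of the decision `d` in the round
with (zero-based) index `t`, given that the arrival sequence is `a` and that `h` is the history of the previous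
rounds. Which part of `a` may be used is specified by `IsOnline` and `IsClairvoyant` below. Nothing
about the realization of an edge is known before it is added. -/
structure Policy where
  prob : (Fin I.T → Fin I.nJ) → (t : ℕ) → t < I.T → (Fin t → I.Outcome) → I.Decision → ℝ
  nonneg : ∀ a t ht h d, 0 ≤ prob a t ht h d
  sum_one : ∀ a t ht h, ∑ d, prob a t ht h d = 1
  measurable : ∀ a t ht d, Measurable fun h => prob a t ht h d
  safe : ∀ a t ht h (e : I.Edge), prob a t ht h (some e) ≠ 0 → I.Safe h e

variable {I}

namespace Policy

/-- Law of the outcome of a round, given the history. -/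
def kernel (π : I.Policy) (a : Fin I.T → Fin I.nJ) (t : ℕ) (ht : t < I.T) :
    Kernel (Fin t → I.Outcome) I.Outcome where
  toFun h := ∑ d, ENNReal.ofReal (π.prob a t ht h d) • (I.realizationLaw d).map (fun z => (d, z))
  measurable' := by
    refine Measure.measurable_of_measurable_coe _ fun s _ => ?_
    simp only [Measure.coe_finsetSum, Finset.sum_apply, Measure.smul_apply, smul_eq_mul]
    exact Finset.measurable_sum _ fun d _ => (π.measurable a t ht d).ennreal_ofReal.mul_const _

instance instMarkov (π : I.Policy) (a : Fin I.T → Fin I.nJ) (t : ℕ) (ht : t < I.T) :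
    IsMarkovKernel (π.kernel a t ht) := by
  refine ⟨fun h => ⟨?_⟩⟩
  have hd : ∀ d : I.Decision, ((I.realizationLaw d).map (fun z => (d, z))) Set.univ = 1 := by
    intro d
    rw [Measure.map_apply measurable_prodMk_left MeasurableSet.univ]
    simp
  change (∑ d, ENNReal.ofReal (π.prob a t ht h d) •
    (I.realizationLaw d).map (fun z => (d, z))) Set.univ = 1
  simp only [Measure.coe_finsetSum, Finset.sum_apply, Measure.smul_apply, smul_eq_mul, hd, mul_one]
  rw [← ENNReal.ofReal_sum_of_nonneg fun d _ => π.nonneg a t ht h d, π.sum_one, ENNReal.ofReal_one]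

/-- Law of the history of the first `n` rounds, given the arrival sequence. -/
def historyLaw (π : I.Policy) (a : Fin I.T → Fin I.nJ) :
    (n : ℕ) → n ≤ I.T → Measure (Fin n → I.Outcome)
  | 0, _ => Measure.dirac Fin.elim0
  | n + 1, hn => (π.historyLaw a n (Nat.le_of_succ_le hn) ⊗ₘ π.kernel a n hn).map
      fun q => Fin.snoc (α := fun _ => I.Outcome) q.1 q.2

theorem historyLaw_isProbability (π : I.Policy) (a : Fin I.T → Fin I.nJ) (n : ℕ) (hn : n ≤ I.T) :
    IsProbabilityMeasure (π.historyLaw a n hn) := by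
  induction n with
  | zero => exact inferInstanceAs (IsProbabilityMeasure (Measure.dirac _))
  | succ n ih =>
    have := ih (Nat.le_of_succ_le hn)
    have hm : Measurable fun q : (Fin n → I.Outcome) × I.Outcome =>
        Fin.snoc (α := fun _ => I.Outcome) q.1 q.2 := by
      refine measurable_pi_lambda _ fun i => ?_
      refine Fin.lastCases ?_ (fun j => ?_) i
      · simpa using measurable_snd
      · simp only [Fin.snoc_castSucc]
        exact (measurable_pi_apply j).comp measurable_fst
    exact Measure.isProbabilityMeasure_map hm.aemeasurable

/-- Expected total utility of a policy; the arrivals of the rounds are i.i.d. with law `p`. -/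
def value (π : I.Policy) : ℝ≥0∞ :=
  ∑ a : Fin I.T → Fin I.nJ, (∏ t, (I.p (a t) : ℝ≥0∞)) *
    ∫⁻ h, ∑ t, ((h t).2.2 : ℝ≥0∞) ∂(π.historyLaw a I.T le_rfl)

/-- Online policies: decisions do not depend on future arrivals, and in each round either an edge
incident to the agent that has just arrived is added, or this agent is rejected. -/
structure IsOnline (π : I.Policy) : Prop where
  nonanticipating : ∀ a a' t ht h d, (∀ s : Fin I.T, s.1 ≤ t → a s = a' s) →
    π.prob a t ht h d = π.prob a' t ht h d
  incident : ∀ a t ht h (e : I.Edge), π.prob a t ht h (some e) ≠ 0 → e.1.2 = a ⟨t, ht⟩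

/-- Clairvoyant policies: they know the whole arrival sequence before any decision. The arrived
agents may be processed in any order; the number of edges that are added at an online agent never
exceeds its number of arrivals. -/
def IsClairvoyant (π : I.Policy) : Prop :=
  ∀ a t ht h (e : I.Edge), π.prob a t ht h (some e) ≠ 0 →
    I.matched h e.1.2 < (Finset.univ.filter fun s => a s = e.1.2).card

end Policy

variable (I)

/-- Expected total utility of a clairvoyant optimum. -/
def optValue : ℝ≥0∞ := ⨆ (π : I.Policy) (_ : π.IsClairvoyant), π.value

/-! ### The sampling algorithm -/

open Classical in
/-- Probability that the sampling algorithm adds the edge `e` when `j` arrives after the history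
`h`: the edge is sampled with probability `α x_e / r_j`, and added if it is safe. -/
def sampEdge (α : ℝ) (x : I.Edge → ℝ) (j : Fin I.nJ) {t : ℕ} (h : Fin t → I.Outcome)
    (e : I.Edge) : ℝ :=
  if e.1.2 = j ∧ I.Safe h e then α * x e / I.rate j else 0

theorem sampEdge_nonneg {α : ℝ} (hα : α ∈ Set.Icc (0 : ℝ) 1) {x : I.Edge → ℝ}
    (hx : I.LPFeasible x) (j : Fin I.nJ) {t : ℕ} (h : Fin t → I.Outcome) (e : I.Edge) :
    0 ≤ I.sampEdge α x j h e := by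
  unfold sampEdge
  split_ifs
  · exact div_nonneg (mul_nonneg hα.1 (hx.nonneg e)) (by unfold rate; positivity)
  · exact le_rfl

theorem sum_sampEdge_le {α : ℝ} (hα : α ∈ Set.Icc (0 : ℝ) 1) {x : I.Edge → ℝ}
    (hx : I.LPFeasible x) (j : Fin I.nJ) {t : ℕ} (h : Fin t → I.Outcome) :
    ∑ e, I.sampEdge α x j h e ≤ 1 := by
  have hr : 0 ≤ I.rate j := by unfold rate; positivity
  calc ∑ e, I.sampEdge α x j h e
      ≤ ∑ e : I.Edge, if e.1.2 = j then x e / I.rate j else 0 := by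
        refine Finset.sum_le_sum fun e _ => ?_
        have h0 := hx.nonneg e
        have h1 : α * x e / I.rate j ≤ x e / I.rate j := by
          apply div_le_div_of_nonneg_right _ hr
          nlinarith [hα.2]
        unfold sampEdge
        split_ifs with h2 h3 h3
        · exact h1
        · exact absurd h2.1 h3
        · positivity
        · exact le_rfl
    _ = (∑ e : I.Edge with e.1.2 = j, x e) / I.rate j := by
        rw [Finset.sum_div, Finset.sum_filter]
    _ ≤ 1 := div_le_one_of_le₀ (hx.arrival j) hr

theorem measurable_sampEdge (α : ℝ) (x : I.Edge → ℝ) (j : Fin I.nJ) (t : ℕ) (e : I.Edge) :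
    Measurable fun h : Fin t → I.Outcome => I.sampEdge α x j h e := by
  classical
  let f : (Fin t → I.Outcome) → (Fin t → Fin I.K → Bool) := fun h s => (h s).2.1
  have hf : Measurable f := by fun_prop
  let g : (Fin t → Fin I.K → Bool) → ℝ := fun c =>
    if e.1.2 = j ∧ ∀ k ∈ I.support e, (Finset.univ.filter fun s => c s k = true).card + 1 ≤
      I.budget k then α * x e / I.rate j else 0
  have hg : Measurable g := measurable_of_countable g
  have : (fun h : Fin t → I.Outcome => I.sampEdge α x j h e) = g ∘ f := by
    funext h
    simp only [sampEdge, Safe, consumed, g, f, Function.comp]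
    congr
  rw [this]
  exact hg.comp hf

/-- The LP-based sampling algorithm with parameter `α`, run with the LP solution `x`. -/
def samp (α : ℝ) (hα : α ∈ Set.Icc (0 : ℝ) 1) (x : I.Edge → ℝ) (hx : I.LPFeasible x) :
    I.Policy where
  prob a t ht h d := match d with
    | some e => I.sampEdge α x (a ⟨t, ht⟩) h e
    | none => 1 - ∑ e, I.sampEdge α x (a ⟨t, ht⟩) h e
  nonneg := by
    rintro a t ht h (_ | e)
    · exact sub_nonneg.2 (I.sum_sampEdge_le hα hx _ h)
    · exact I.sampEdge_nonneg hα hx _ h e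
  sum_one := by
    intro a t ht h
    refine (Fintype.sum_option (α := I.Edge) _).trans ?_
    simp
  measurable := by
    rintro a t ht (_ | e)
    · exact measurable_const.sub
        (Finset.measurable_sum _ fun e _ => I.measurable_sampEdge α x (a ⟨t, ht⟩) t e)
    · exact I.measurable_sampEdge α x (a ⟨t, ht⟩) t e
  safe := by
    intro a t ht h e he
    by_contra hs
    exact he (if_neg fun hc => hs hc.2)

theorem samp_isOnline (α : ℝ) (hα : α ∈ Set.Icc (0 : ℝ) 1) (x : I.Edge → ℝ)
    (hx : I.LPFeasible x) : (I.samp α hα x hx).IsOnline where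
  nonanticipating := by
    rintro a a' t ht h d ha
    simp only [samp, ha ⟨t, ht⟩ le_rfl]
  incident := by
    intro a t ht h e he
    by_contra hs
    exact he (if_neg fun hc => hs hc.1)

/-! ### Competitive ratios -/

/-- Instances with horizon `T`, sparsity at most `Δ` and smallest budget `B`. -/
structure InClass (Δ B T : ℕ) (I : MBOSM) : Prop where
  horizon : I.T = T
  sparsity : ∀ e, (I.support e).card ≤ Δ
  minBudget : IsLeast (Set.range I.budget) B

/-- The competitive ratios with respect to the benchmark LP that are achieved by the sampling
algorithm with `α = 1`, whichever optimal LP solution it uses. -/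
def sampRatios (Δ B T : ℕ) : Set ℝ :=
  {ρ | ρ ∈ Set.Icc (0 : ℝ) 1 ∧ ∀ I : MBOSM, InClass Δ B T I → ∀ x (hx : I.LPOptimal x),
    ENNReal.ofReal ρ * I.lpValue ≤ (I.samp 1 ⟨zero_le_one, le_rfl⟩ x hx.1).value}

/-- The competitive ratios with respect to a clairvoyant optimum that are achieved by the sampling
algorithm with `α = 1`, whichever optimal LP solution it uses. -/
def sampOptRatios (Δ B T : ℕ) : Set ℝ :=
  {ρ | ρ ∈ Set.Icc (0 : ℝ) 1 ∧ ∀ I : MBOSM, InClass Δ B T I → ∀ x (hx : I.LPOptimal x),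
    ENNReal.ofReal ρ * I.optValue ≤ (I.samp 1 ⟨zero_le_one, le_rfl⟩ x hx.1).value}

/-- The competitive ratios with respect to the benchmark LP that are achieved by some online
algorithm. An algorithm knows the instance, so that it is a choice of a policy for each instance. -/
def onlineRatios (Δ B T : ℕ) : Set ℝ :=
  {ρ | ρ ∈ Set.Icc (0 : ℝ) 1 ∧ ∃ ALG : (I : MBOSM) → I.Policy, (∀ I, (ALG I).IsOnline) ∧
    ∀ I : MBOSM, InClass Δ B T I → ENNReal.ofReal ρ * I.lpValue ≤ (ALG I).value}

/-- The regime `T ≫ B ≫ 1` for pairs `(B, T)`. -/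
def regimeOne : Filter (ℕ × ℕ) :=
  comap (fun q => (q.1 : ℝ)) atTop ⊓ comap (fun q => (q.2 : ℝ) / q.1) atTop

/-- The regime `T ≫ B ≫ ln Δ ≫ 1` for triples `(Δ, B, T)`. -/
def regimeGeneral : Filter (ℕ × ℕ × ℕ) :=
  comap (fun q => Real.log q.1) atTop ⊓ comap (fun q => (q.2.1 : ℝ) / Real.log q.1) atTop ⊓
    comap (fun q => (q.2.2 : ℝ) / q.2.1) atTop

end MBOSM

end

/-! The constant is κ = √2, and everything reduces to tails of P(Bin(t, b/T) ≥ b), where b is a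
budget and t < T is the number of earlier rounds.

Lower bound on the ratio. Averaged over the arrival, `SAMP(1)` adds a safe edge e with probability
x_e/T, so by the budget constraint of the LP each round consumes resource k with conditional
probability at most B_k/T, whatever the history. Hence the consumption before round t is dominated
by Bin(t, B_k/T) (`arrivalAvg_binomTail_le`), and a union bound over the support controls the
probability that e is unsafe. The relative loss is thus at most the average over t of the capped sum
of tails (`mem_sampRatios`). For Δ = 1 this average has a closed form, (1 - b/T) P(Bin(T, b/T) = b),
a mean-deviation identity (`sum_binomTail_div`), and Stirling gives 1/√(2πB). For general Δ, the
Chernoff bound exp(-B(1 - t/T)²/2) multiplied by Δ is below 1 until the last fraction s = √(2 ln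
Δ/B) of the horizon, so the average is s(1+o(1)) at most (`sum_min_exp_le`).

Upper bound for every algorithm. Take a single edge of unit utility that consumes each of Δ
resources independently with probability B/T. The LP value is at least T, while no policy beats
adding the edge whenever it is safe; a supermartingale argument (`value_le_greedyAdds`) bounds the
value by the sum over t of (1 - P(Bin(t, B/T) ≥ B))^Δ. For Δ = 1 this matches the loss above exactly
up to the Stirling correction. For general Δ, exponential tilting shows that at t = (1 - cs)T with c
< 1 the tail is about Δ^(-c²), so its product with Δ diverges and the last fraction cs of the rounds
earns almost nothing (`eventually_sum_one_sub_binomTail_pow_le`).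

Against OPT, the expected numbers of additions of any clairvoyant policy form a feasible LP
solution, so OPT is at most the LP value and the LP guarantee transfers. Finally, the set of ratios
of the sampling algorithm is compact, so a largest one exists; it is at most the best online ratio,
and the two bounds squeeze both. -/

/-! ### Binomial tails: recursion, mean deviation, Chernoff bound -/

/-- The probability that a binomial random variable with parameters `n` and `p` is at least `b`. -/
noncomputable def binomTail (p : ℝ) : ℕ → ℕ → ℝ
  | _, 0 => 1
  | 0, _ + 1 => 0
  | n + 1, b + 1 => p * binomTail p n b + (1 - p) * binomTail p n (b + 1)

/-- The probability that a binomial random variable with parameters `n` and `p` equals `b`. -/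
noncomputable def binomMass (p : ℝ) (n b : ℕ) : ℝ := n.choose b * p ^ b * (1 - p) ^ (n - b)

@[simp] theorem binomTail_zero_right (p : ℝ) (n : ℕ) : binomTail p n 0 = 1 := by
  cases n <;> simp [binomTail]

@[simp] theorem binomTail_zero_left (p : ℝ) (b : ℕ) : binomTail p 0 (b + 1) = 0 := by
  simp [binomTail]

theorem binomTail_succ_succ (p : ℝ) (n b : ℕ) :
    binomTail p (n + 1) (b + 1) = p * binomTail p n b + (1 - p) * binomTail p n (b + 1) := by
  simp [binomTail]

theorem binomTail_nonneg {p : ℝ} (h0 : 0 ≤ p) (h1 : p ≤ 1) (n b : ℕ) : 0 ≤ binomTail p n b := by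
  induction n generalizing b with
  | zero => cases b <;> simp
  | succ n ih =>
    cases b with
    | zero => simp
    | succ b =>
      rw [binomTail_succ_succ]
      have := ih b
      have := ih (b + 1)
      have : 0 ≤ 1 - p := by linarith
      positivity

theorem binomTail_succ_le {p : ℝ} (h0 : 0 ≤ p) (h1 : p ≤ 1) (n b : ℕ) :
    binomTail p n (b + 1) ≤ binomTail p n b := by
  induction n generalizing b with
  | zero => cases b <;> simp
  | succ n ih =>
    cases b with
    | zero =>
      rw [binomTail_succ_succ]
      have := ih 0
      simp only [binomTail_zero_right] at this ⊢
      nlinarith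
    | succ b =>
      rw [binomTail_succ_succ, binomTail_succ_succ]
      have := ih b
      have := ih (b + 1)
      have : 0 ≤ 1 - p := by linarith
      gcongr

theorem binomTail_antitone {p : ℝ} (h0 : 0 ≤ p) (h1 : p ≤ 1) (n : ℕ) :
    Antitone (binomTail p n) :=
  antitone_nat_of_succ_le fun b => binomTail_succ_le h0 h1 n b

theorem binomTail_le_one {p : ℝ} (h0 : 0 ≤ p) (h1 : p ≤ 1) (n b : ℕ) : binomTail p n b ≤ 1 := by
  simpa using binomTail_antitone h0 h1 n (Nat.zero_le b)

theorem binomTail_mono_left {p : ℝ} (h0 : 0 ≤ p) (h1 : p ≤ 1) (b : ℕ) :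
    Monotone fun n => binomTail p n b := by
  refine monotone_nat_of_le_succ fun n => ?_
  cases b with
  | zero => simp
  | succ b =>
    rw [binomTail_succ_succ]
    nlinarith [binomTail_succ_le h0 h1 n b]

theorem binomTail_eq_zero (p : ℝ) {n b : ℕ} (h : n < b) : binomTail p n b = 0 := by
  induction n generalizing b with
  | zero =>
    obtain ⟨b, rfl⟩ := Nat.exists_eq_succ_of_ne_zero h.ne'
    simp
  | succ n ih =>
    obtain ⟨b, rfl⟩ := Nat.exists_eq_succ_of_ne_zero (Nat.ne_zero_of_lt h)
    rw [Nat.succ_eq_add_one, binomTail_succ_succ, ih (by omega), ih (by omega)]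
    simp

theorem binomMass_succ_zero (p : ℝ) (n : ℕ) : binomMass p (n + 1) 0 = (1 - p) * binomMass p n 0 := by
  simp [binomMass, pow_succ, mul_comm]

theorem binomMass_succ_succ (p : ℝ) (n b : ℕ) :
    binomMass p (n + 1) (b + 1) = p * binomMass p n b + (1 - p) * binomMass p n (b + 1) := by
  unfold binomMass
  rcases Nat.lt_or_ge b n with h | h
  · obtain ⟨k, rfl⟩ := Nat.exists_eq_add_of_lt h
    rw [Nat.choose_succ_succ, show b + k + 1 + 1 - (b + 1) = k + 1 by omega,
      show b + k + 1 - b = k + 1 by omega, show b + k + 1 - (b + 1) = k by omega]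
    push_cast
    ring
  · rw [Nat.choose_succ_succ, Nat.choose_eq_zero_of_lt (by omega : n < b + 1),
      show n + 1 - (b + 1) = n - b by omega]
    push_cast
    ring

/-- Both sides obey the same Pascal recursion; this ties the recursively defined tail to the closed
form of the mass. -/
theorem binomTail_sub_succ (p : ℝ) (n b : ℕ) :
    binomTail p n b - binomTail p n (b + 1) = binomMass p n b := by
  induction n generalizing b with
  | zero => cases b <;> simp [binomMass]
  | succ n ih =>
    cases b with
    | zero =>
      rw [binomTail_succ_succ, binomMass_succ_zero, ← ih]
      simp only [binomTail_zero_right]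
      ring
    | succ b =>
      rw [binomTail_succ_succ, binomTail_succ_succ, binomMass_succ_succ, ← ih, ← ih]
      ring

theorem binomTail_eq_sum (p : ℝ) {n b : ℕ} (h : b ≤ n + 1) :
    binomTail p n b = ∑ j ∈ Finset.Ico b (n + 1), binomMass p n j := by
  simp_rw [← binomTail_sub_succ]
  have h2 := Finset.sum_range_sub' (fun i => binomTail p n (b + i)) (n + 1 - b)
  simp only [← add_assoc, add_zero] at h2
  rw [Finset.sum_Ico_eq_sum_range, h2, Nat.add_sub_cancel' h,
    binomTail_eq_zero p (Nat.lt_succ_self n), sub_zero]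

/-- Both sides are the expectation of min(Bin(n, p), b): on the left it grows by p times the
probability that the count before a trial is below b, on the right it is a sum of tails. -/
theorem mul_sum_one_sub_binomTail (p : ℝ) (n b : ℕ) :
    p * ∑ t ∈ Finset.range n, (1 - binomTail p t b) =
      ∑ i ∈ Finset.range b, binomTail p n (i + 1) := by
  induction n with
  | zero => simp
  | succ n ih =>
    rw [Finset.sum_range_succ, mul_add, ih]
    simp_rw [binomTail_succ_succ]
    have h := Finset.sum_range_sub' (fun i => binomTail p n i) b
    simp only [binomTail_zero_right] at h
    rw [← h, Finset.mul_sum, ← Finset.sum_add_distrib]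
    exact Finset.sum_congr rfl fun i _ => by ring

/-- The ratio of consecutive masses, cleared of denominators so that it survives p = 1 and b ≥ n. -/
theorem succ_mul_binomMass_succ (p : ℝ) (n b : ℕ) :
    (b + 1 : ℝ) * ((1 - p) * binomMass p n (b + 1)) = (n - b) * (p * binomMass p n b) := by
  unfold binomMass
  rcases Nat.lt_or_ge b n with h | h
  · have hc := Nat.choose_succ_right_eq n b
    have hc' : (n.choose (b + 1) : ℝ) * (b + 1) = n.choose b * (n - b) := by
      rw [← Nat.cast_sub h.le]
      exact_mod_cast hc
    obtain ⟨k, rfl⟩ := Nat.exists_eq_add_of_lt h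
    rw [show b + k + 1 - b = k + 1 by omega, show b + k + 1 - (b + 1) = k by omega]
    linear_combination p ^ (b + 1) * (1 - p) ^ (k + 1) * hc'
  · rw [Nat.choose_eq_zero_of_lt (by omega : n < b + 1)]
    rcases h.eq_or_lt with rfl | h
    · simp
    · simp [Nat.choose_eq_zero_of_lt h]

/-- De Moivre's closed form for the expectation of min(Bin(n, p), b); the ratio of consecutive
masses makes the induction on b telescope. -/
theorem sum_binomTail_succ (p : ℝ) (n b : ℕ) :
    ∑ i ∈ Finset.range b, binomTail p n (i + 1) =
      b - (b - n * p) * (1 - binomTail p n b) - b * ((1 - p) * binomMass p n b) := by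
  induction b with
  | zero => simp
  | succ b ih =>
    rw [Finset.sum_range_succ, ih]
    push_cast
    rw [succ_mul_binomMass_succ, ← binomTail_sub_succ]
    ring

/-- Mean deviation of a binomial random variable with integer mean. -/
theorem sum_binomTail_div {T b : ℕ} (hb : 0 < b) (hT : 0 < T) :
    ∑ t ∈ Finset.range T, binomTail (b / T) t b =
      T * ((1 - b / T) * binomMass (b / T) T b) := by
  have hT' : (T : ℝ) ≠ 0 := by positivity
  have hb' : (b : ℝ) ≠ 0 := by positivity
  have h := mul_sum_one_sub_binomTail (b / T) T b
  -- With n = T and p = b/T the term b - np vanishes, and only the mass at b survives.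
  rw [sum_binomTail_succ, mul_div_cancel₀ _ hT', Finset.sum_sub_distrib] at h
  simp only [Finset.sum_const, Finset.card_range, nsmul_eq_mul, mul_one, sub_self, zero_mul,
    sub_zero] at h
  rw [div_mul_eq_mul_div, div_eq_iff hT'] at h
  apply mul_left_cancel₀ hb'
  linear_combination -h

/-- Markov's inequality for c^X with X binomial, whose expectation is (1 - p + pc)^n, carried out by
conditioning on one trial. -/
theorem binomTail_mul_pow_le {p c : ℝ} (h0 : 0 ≤ p) (h1 : p ≤ 1) (hc : 1 ≤ c) (n b : ℕ) :
    binomTail p n b * c ^ b ≤ (1 - p + p * c) ^ n := by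
  induction n generalizing b with
  | zero => cases b <;> simp
  | succ n ih =>
    cases b with
    | zero =>
      simp only [binomTail_zero_right, pow_zero, mul_one]
      exact one_le_pow₀ (by nlinarith)
    | succ b =>
      rw [binomTail_succ_succ]
      have h2 := mul_le_mul_of_nonneg_left (ih b) (by positivity : 0 ≤ p * c)
      have h3 := mul_le_mul_of_nonneg_left (ih (b + 1)) (by linarith : 0 ≤ 1 - p)
      calc _ = p * c * (binomTail p n b * c ^ b) +
            (1 - p) * (binomTail p n (b + 1) * c ^ (b + 1)) := by ring
        _ ≤ p * c * (1 - p + p * c) ^ n + (1 - p) * (1 - p + p * c) ^ n := add_le_add h2 h3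
        _ = _ := by ring

theorem Real.log_one_sub_le {y : ℝ} (h0 : 0 ≤ y) (h1 : y < 1) :
    Real.log (1 - y) ≤ -y - y ^ 2 / 2 := by
  have h := Real.hasSum_pow_div_log_of_abs_lt_one (x := y) (by rwa [abs_of_nonneg h0])
  have h2 := sum_le_hasSum (Finset.range 2) (fun i _ => by positivity) h
  norm_num [Finset.sum_range_succ] at h2
  linarith

/-- The difference of the two sides vanishes at 0 and has derivative y³/(1 + y). -/
theorem Real.log_one_add_le {x : ℝ} (h0 : 0 ≤ x) :
    Real.log (1 + x) ≤ x - x ^ 2 / 2 + x ^ 3 / 3 := by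
  have hd : ∀ y : ℝ, 0 ≤ y → HasDerivAt
      (fun y : ℝ => y - y ^ 2 / 2 + y ^ 3 / 3 - Real.log (1 + y)) (y ^ 3 / (1 + y)) y := by
    intro y hy
    have hy' : 1 + y ≠ 0 := by positivity
    have h1 := (hasDerivAt_id y).sub ((hasDerivAt_pow 2 y).div_const 2) |>.add
      ((hasDerivAt_pow 3 y).div_const 3) |>.sub (((hasDerivAt_id y).const_add 1).log hy')
    refine h1.congr_deriv ?_
    simp only [id]
    field_simp
    push_cast
    ring
  have hm : MonotoneOn (fun y : ℝ => y - y ^ 2 / 2 + y ^ 3 / 3 - Real.log (1 + y))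
      (Set.Ici 0) := by
    refine monotoneOn_of_deriv_nonneg (convex_Ici 0)
      (fun y hy => (hd y hy).continuousAt.continuousWithinAt)
      (fun y hy => ?_) fun y hy => ?_
    · rw [interior_Ici] at hy
      exact (hd y (le_of_lt hy)).differentiableAt.differentiableWithinAt
    · rw [interior_Ici] at hy
      have hy0 : (0 : ℝ) < y := hy
      rw [(hd y hy0.le).deriv]
      positivity
  have := hm (Set.self_mem_Ici) (Set.mem_Ici.2 h0) h0
  simp at this
  linarith

/-- Chernoff bound for a binomial random variable whose mean is the fraction `t / T` of `b`. -/
theorem binomTail_le_exp {T b t : ℕ} (hbT : b ≤ T) (htT : t < T) :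
    binomTail (b / T) t b ≤ Real.exp (-(b * (1 - t / T) ^ 2 / 2)) := by
  have hT : (0 : ℝ) < T := by exact_mod_cast (Nat.zero_le t).trans_lt htT
  have hp1 : (b / T : ℝ) ≤ 1 := (div_le_one hT).2 (by exact_mod_cast hbT)
  have hp0 : (0 : ℝ) ≤ b / T := by positivity
  rcases Nat.eq_zero_or_pos t with rfl | ht
  · cases b with
    | zero => simp
    | succ b =>
      rw [binomTail_zero_left]
      exact (Real.exp_pos _).le
  have ht0 : (0 : ℝ) < t := by exact_mod_cast ht
  have htT' : (t : ℝ) < T := by exact_mod_cast htT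
  set r : ℝ := t / T with hr
  have hr0 : 0 < r := by positivity
  have hr1 : r < 1 := (div_lt_one hT).2 htT'
  -- The choice c = T/t is the ratio of the threshold b to the mean bt/T. The linear terms b(1 - r)
  -- in the two factors bounded next cancel, leaving the quadratic one.
  have h := binomTail_mul_pow_le hp0 hp1 (c := r⁻¹) (one_le_inv_iff₀.2 ⟨hr0, hr1.le⟩) t b
  have h2 : (1 - b / T + b / T * r⁻¹) ^ t ≤ Real.exp (b * (1 - r)) := by
    have : 1 - b / T + b / T * r⁻¹ ≤ Real.exp (b / T * (r⁻¹ - 1)) := by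
      have := Real.add_one_le_exp (b / T * (r⁻¹ - 1))
      linarith
    calc _ ≤ Real.exp (b / T * (r⁻¹ - 1)) ^ t := by
          gcongr
      _ = _ := by
          rw [← Real.exp_nat_mul]
          congr 1
          rw [hr]
          field_simp
  have h3 : r ^ b ≤ Real.exp (-(b * ((1 - r) + (1 - r) ^ 2 / 2))) := by
    have : r ≤ Real.exp (-((1 - r) + (1 - r) ^ 2 / 2)) := by
      rw [← Real.log_le_iff_le_exp hr0]
      have h4 := Real.log_one_sub_le (y := 1 - r) (by linarith) (by linarith)
      rw [sub_sub_cancel] at h4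
      linarith
    calc r ^ b ≤ Real.exp (-((1 - r) + (1 - r) ^ 2 / 2)) ^ b := by gcongr
      _ = _ := by
          rw [← Real.exp_nat_mul]
          congr 1
          ring
  calc binomTail (b / T) t b = binomTail (b / T) t b * r⁻¹ ^ b * r ^ b := by
        rw [mul_assoc, ← mul_pow, inv_mul_cancel₀ hr0.ne', one_pow, mul_one]
    _ ≤ Real.exp (b * (1 - r)) * Real.exp (-(b * ((1 - r) + (1 - r) ^ 2 / 2))) := by
        gcongr
        exact h.trans h2
    _ = _ := by
        rw [← Real.exp_add]
        congr 1
        ring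

/-! ### Lower bound on binomial tails by exponential tilting -/

/-- Gives total mass and variance of the binomial law from the known identities for Bernstein
polynomials. -/
theorem eval_bernsteinPolynomial (q : ℝ) (n j : ℕ) :
    (bernsteinPolynomial ℝ n j).eval q = binomMass q n j := by
  simp [bernsteinPolynomial, binomMass]

theorem sum_binomMass (q : ℝ) (n : ℕ) : ∑ j ∈ Finset.range (n + 1), binomMass q n j = 1 := by
  have h := congrArg (Polynomial.eval q) (bernsteinPolynomial.sum ℝ n)
  simpa [Polynomial.eval_finsetSum, eval_bernsteinPolynomial] using h

theorem variance_binomMass (q : ℝ) (n : ℕ) :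
    ∑ j ∈ Finset.range (n + 1), (n * q - j) ^ 2 * binomMass q n j = n * q * (1 - q) := by
  have h := congrArg (Polynomial.eval q) (bernsteinPolynomial.variance ℝ n)
  simpa [Polynomial.eval_finsetSum, eval_bernsteinPolynomial] using h

theorem binomMass_nonneg {p : ℝ} (h0 : 0 ≤ p) (h1 : p ≤ 1) (n b : ℕ) : 0 ≤ binomMass p n b := by
  have : 0 ≤ 1 - p := by linarith
  unfold binomMass
  positivity

/-- Chebyshev's inequality: the variance nq(1 - q) is at most L²/2. -/
theorem half_le_sum_binomMass {q L : ℝ} (h0 : 0 ≤ q) (h1 : q ≤ 1) (hL : 0 < L) {n : ℕ}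
    (hvar : 2 * (n * q) ≤ L ^ 2) :
    1 / 2 ≤ ∑ j ∈ Finset.range (n + 1) with |n * q - (j : ℕ)| ≤ L, binomMass q n j := by
  have hL2 : 0 < L ^ 2 := by positivity
  have hsplit := Finset.sum_filter_add_sum_filter_not (Finset.range (n + 1))
    (fun j : ℕ => |n * q - (j : ℕ)| ≤ L) (binomMass q n)
  rw [sum_binomMass] at hsplit
  have hle : L ^ 2 * ∑ j ∈ Finset.range (n + 1) with ¬ |n * q - (j : ℕ)| ≤ L, binomMass q n j ≤
      n * q * (1 - q) := by
    rw [← variance_binomMass, Finset.mul_sum]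
    refine (Finset.sum_le_sum fun j hj => ?_).trans
      (Finset.sum_le_sum_of_subset_of_nonneg (Finset.filter_subset _ _) fun j _ _ =>
        mul_nonneg (sq_nonneg _) (binomMass_nonneg h0 h1 _ _))
    have hj' : L ≤ |n * q - j| := by
      have := (Finset.mem_filter.1 hj).2
      linarith
    refine mul_le_mul_of_nonneg_right ?_ (binomMass_nonneg h0 h1 _ _)
    rw [← sq_abs (n * q - j)]
    gcongr
  have h3 : (n : ℝ) * q * (1 - q) ≤ L ^ 2 / 2 := by
    have : (0 : ℝ) ≤ n * q := by positivity
    nlinarith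
  have h4 : ∑ j ∈ Finset.range (n + 1) with ¬ |n * q - (j : ℕ)| ≤ L, binomMass q n j ≤ 1 / 2 := by
    by_contra hc
    have := mul_lt_mul_of_pos_left (not_le.1 hc) hL2
    linarith
  linarith

/-- Lower bound for the tail of a binomial random variable by exponential tilting. -/
theorem half_mul_exp_le_binomTail {p q L : ℝ} {m B : ℕ} (hp : 0 < p) (hpq : p ≤ q) (hq : q < 1)
    (hL : 0 < L) (hmq : m * q = B + L) (hvar : 2 * (m * q) ≤ L ^ 2) :
    1 / 2 * Real.exp (-((B + 2 * L) * Real.log (q / p) +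
      (m - (B + 2 * L)) * Real.log ((1 - q) / (1 - p)))) ≤ binomTail p m B := by
  have hq0 : 0 < q := hp.trans_le hpq
  have hp1 : p < 1 := hpq.trans_lt hq
  have hBm : (B : ℝ) ≤ m := by
    have : (m : ℝ) * q ≤ m := mul_le_of_le_one_right (by positivity) hq.le
    linarith
  have hBm' : B ≤ m := by exact_mod_cast hBm
  have ha : 0 ≤ Real.log (q / p) := Real.log_nonneg ((one_le_div hp).2 hpq)
  have hb : Real.log ((1 - q) / (1 - p)) ≤ 0 :=
    Real.log_nonpos (div_nonneg (by linarith) (by linarith))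
      ((div_le_one (by linarith)).2 (by linarith))
  have hpe : p = q * Real.exp (-Real.log (q / p)) := by
    rw [Real.exp_neg, Real.exp_log (by positivity)]
    field_simp
  have hpe' : 1 - p = (1 - q) * Real.exp (-Real.log ((1 - q) / (1 - p))) := by
    rw [Real.exp_neg, Real.exp_log (div_pos (by linarith) (by linarith))]
    have : 1 - q ≠ 0 := by linarith
    field_simp
  set α := Real.log (q / p)
  set β := Real.log ((1 - q) / (1 - p))
  calc _ ≤ (∑ j ∈ Finset.range (m + 1) with |m * q - (j : ℕ)| ≤ L, binomMass q m j) *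
        Real.exp (-((B + 2 * L) * α + (m - (B + 2 * L)) * β)) := by
        gcongr
        exact half_le_sum_binomMass hq0.le hq.le hL hvar
    _ ≤ ∑ j ∈ Finset.range (m + 1) with |m * q - (j : ℕ)| ≤ L, binomMass p m j := by
        rw [Finset.sum_mul]
        refine Finset.sum_le_sum fun j hj => ?_
        rw [Finset.mem_filter, abs_le, Finset.mem_range] at hj
        have hjm : j ≤ m := by omega
        -- This is the likelihood ratio of p against q at j. Since α ≥ 0 ≥ β, it is smallest at the
        -- right end B + 2L of the window [B, B + 2L], which is centred at mq = B + L.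
        have hE : Real.exp (-((B + 2 * L) * α + (m - (B + 2 * L)) * β)) ≤
            Real.exp (-α) ^ j * Real.exp (-β) ^ (m - j) := by
          rw [← Real.exp_nat_mul, ← Real.exp_nat_mul, ← Real.exp_add, Nat.cast_sub hjm]
          refine Real.exp_le_exp.2 ?_
          have : (j : ℝ) ≤ B + 2 * L := by linarith
          nlinarith
        have hm : binomMass p m j = binomMass q m j *
            (Real.exp (-α) ^ j * Real.exp (-β) ^ (m - j)) := by
          unfold binomMass
          conv_lhs => rw [hpe', hpe]
          rw [mul_pow, mul_pow]
          ring
        rw [hm]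
        exact mul_le_mul_of_nonneg_left hE (binomMass_nonneg hq0.le hq.le _ _)
    _ ≤ _ := by
        rw [binomTail_eq_sum p (by omega)]
        refine Finset.sum_le_sum_of_subset_of_nonneg (fun j hj => ?_) fun j _ _ =>
          binomMass_nonneg hp.le hp1.le _ _
        rw [Finset.mem_filter, abs_le, Finset.mem_range] at hj
        rw [Finset.mem_Ico]
        refine ⟨?_, hj.1⟩
        have : (B : ℝ) ≤ j := by linarith
        exact_mod_cast this

/-! ### Loss from a single resource and its Stirling asymptotics -/

/-- The average over `t < T` of the probability that a binomial random variable with parameters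
`t` and `b / T` is at least `b`. -/
noncomputable def binomLoss (b T : ℕ) : ℝ := (∑ t ∈ Finset.range T, binomTail (b / T) t b) / T

theorem binomLoss_eq {b T : ℕ} (hb : 0 < b) (hT : 0 < T) :
    binomLoss b T = (1 - b / T) * binomMass (b / T) T b := by
  have : (T : ℝ) ≠ 0 := by positivity
  rw [binomLoss, sum_binomTail_div hb hT, mul_div_cancel_left₀ _ this]

theorem Nat.cast_factorial_eq_stirlingSeq {n : ℕ} (hn : 0 < n) :
    (n.factorial : ℝ) = Stirling.stirlingSeq n * (√(2 * n) * (n / Real.exp 1) ^ n) := by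
  unfold Stirling.stirlingSeq
  field_simp

/-- In the binomial coefficient at mean b, the powers and exponentials of Stirling's formula cancel,
so only Stirling ratios and square roots remain. -/
theorem binomLoss_eq_stirlingSeq {b T : ℕ} (hb : 0 < b) (hbT : b < T) :
    binomLoss b T =
      Stirling.stirlingSeq T / (Stirling.stirlingSeq b * Stirling.stirlingSeq (T - b)) * (√(1 - b / T) / √(2 * b)) := by
  obtain ⟨c, rfl⟩ := Nat.exists_eq_add_of_lt hbT
  obtain ⟨d, hd⟩ : ∃ d, d = c + 1 := ⟨_, rfl⟩
  rw [add_assoc, ← hd]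
  have hd0 : 0 < d := by omega
  rw [binomLoss_eq hb (by omega), binomMass, Nat.choose_eq_factorial_div_factorial
    (Nat.le_add_right b d), Nat.add_sub_cancel_left, Nat.cast_div
    (Nat.factorial_mul_factorial_dvd_factorial_add b d) (by positivity),
    Nat.cast_mul, Nat.cast_factorial_eq_stirlingSeq hb, Nat.cast_factorial_eq_stirlingSeq hd0,
    Nat.cast_factorial_eq_stirlingSeq (by omega : 0 < b + d)]
  have hq : 1 - (b : ℝ) / (b + d : ℕ) = d / (b + d) := by
    push_cast
    field_simp
    ring
  rw [hq]
  have h1 : 0 < Stirling.stirlingSeq b := by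
    obtain ⟨b, rfl⟩ := Nat.exists_eq_succ_of_ne_zero hb.ne'
    exact Stirling.stirlingSeq'_pos b
  have h2 : 0 < Stirling.stirlingSeq d := by
    obtain ⟨b, rfl⟩ := Nat.exists_eq_succ_of_ne_zero hd0.ne'
    exact Stirling.stirlingSeq'_pos b
  push_cast
  have hbd : (0 : ℝ) < b + d := by positivity
  have hbr : (0 : ℝ) < b := by positivity
  have hdr : (0 : ℝ) < d := by positivity
  rw [Real.sqrt_div hdr.le, Real.sqrt_mul (by norm_num), Real.sqrt_mul (by norm_num),
    Real.sqrt_mul (by norm_num), pow_add, div_pow, div_pow, div_pow, div_pow, div_pow, div_pow]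
  have e1 := Real.mul_self_sqrt hbd.le
  have e2 := Real.mul_self_sqrt hdr.le
  have p1 : 0 < √((b : ℝ) + d) := Real.sqrt_pos.2 hbd
  have p2 : 0 < √(d : ℝ) := Real.sqrt_pos.2 hdr
  have p3 : 0 < √(b : ℝ) := Real.sqrt_pos.2 hbr
  have p4 : 0 < √(2 : ℝ) := by positivity
  generalize √((b : ℝ) + d) = u at *
  generalize √(d : ℝ) = v at *
  generalize √(b : ℝ) = w at *
  generalize √(2 : ℝ) = z at *
  have : (d : ℝ) / (b + d) = v * v / (u * u) := by rw [e1, e2]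
  rw [this]
  field_simp

/-- Uniform over all budgets b between B and T: the Stirling ratios of b and T - b are at least √π,
so only the ratio of T, which tends to √π, is left as an error. At b = T the loss is zero. -/
theorem binomLoss_le {B b T : ℕ} (hB : 0 < B) (hBb : B ≤ b) (hbT : b ≤ T) :
    binomLoss b T ≤ 1 / √(2 * Real.pi * B) * (Stirling.stirlingSeq T / √Real.pi) := by
  have hT : 0 < T := by omega
  have hpi : 0 < √Real.pi := Real.sqrt_pos.2 Real.pi_pos
  have hsT := Stirling.sqrt_pi_le_stirlingSeq hT.ne'
  rcases hbT.eq_or_lt with rfl | hbT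
  · rw [binomLoss_eq (by omega) hT, div_self (by positivity)]
    simp only [sub_self, zero_mul]
    have : 0 ≤ Stirling.stirlingSeq b := hpi.le.trans hsT
    positivity
  rw [binomLoss_eq_stirlingSeq (by omega) hbT]
  have h1 := Stirling.sqrt_pi_le_stirlingSeq (n := b) (by omega)
  have h2 := Stirling.sqrt_pi_le_stirlingSeq (n := T - b) (by omega)
  have h3 : √(1 - (b : ℝ) / T) ≤ 1 := by
    rw [Real.sqrt_le_one]
    have : (0 : ℝ) ≤ b / T := by positivity
    linarith
  have hBr : (0 : ℝ) < B := by positivity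
  calc _ ≤ Stirling.stirlingSeq T / (√Real.pi * √Real.pi) * (1 / √(2 * B)) := by
        have : 0 ≤ Stirling.stirlingSeq T := hpi.le.trans hsT
        have : 0 ≤ Stirling.stirlingSeq b := hpi.le.trans h1
        gcongr
    _ = _ := by
        rw [mul_assoc, mul_left_comm, Real.sqrt_mul Real.pi_pos.le]
        field_simp

theorem MBOSM.tendsto_regimeOne_fst : Tendsto (fun q : ℕ × ℕ => q.1) MBOSM.regimeOne atTop := by
  rw [← tendsto_natCast_atTop_iff (R := ℝ)]
  exact tendsto_comap.mono_left inf_le_left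

theorem MBOSM.tendsto_regimeOne_ratio :
    Tendsto (fun q : ℕ × ℕ => (q.2 : ℝ) / q.1) MBOSM.regimeOne atTop :=
  tendsto_comap.mono_left inf_le_right

/-- In this regime B, T and T - B all tend to infinity, so the three Stirling ratios converge to √π,
and B/T tends to 0. -/
theorem tendsto_sqrt_mul_binomLoss : Tendsto (fun q : ℕ × ℕ =>
    √(2 * Real.pi * q.1) * binomLoss q.1 q.2) MBOSM.regimeOne (𝓝 1) := by
  have hB := MBOSM.tendsto_regimeOne_fst
  have hr := MBOSM.tendsto_regimeOne_ratio
  have hBpos : ∀ᶠ q in MBOSM.regimeOne, 0 < q.1 := hB.eventually_gt_atTop 0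
  have h2B : ∀ᶠ q in MBOSM.regimeOne, 2 * q.1 ≤ q.2 := by
    filter_upwards [hBpos, hr.eventually_ge_atTop 2] with q h1 h2
    rw [le_div_iff₀ (by positivity)] at h2
    exact_mod_cast h2
  have hTB : Tendsto (fun q : ℕ × ℕ => q.2 - q.1) MBOSM.regimeOne atTop :=
    tendsto_atTop_mono' _ (h2B.mono fun q hq => by dsimp only; omega) hB
  have hT : Tendsto (fun q : ℕ × ℕ => q.2) MBOSM.regimeOne atTop :=
    tendsto_atTop_mono' _ (h2B.mono fun q hq => by dsimp only; omega) hB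
  have hs := Stirling.tendsto_stirlingSeq_sqrt_pi
  have hpi : √Real.pi ≠ 0 := (Real.sqrt_pos.2 Real.pi_pos).ne'
  have hq : Tendsto (fun q : ℕ × ℕ => √(1 - (q.1 : ℝ) / q.2)) MBOSM.regimeOne (𝓝 1) := by
    have := (hr.inv_tendsto_atTop.const_sub 1).sqrt
    simpa using this
  have := (((hs.comp hT).div ((hs.comp hB).mul (hs.comp hTB)) (mul_ne_zero hpi hpi)).mul
    hq).mul_const (√Real.pi)
  rw [show √Real.pi / (√Real.pi * √Real.pi) * 1 * √Real.pi = 1 by field_simp] at this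
  refine this.congr' ?_
  filter_upwards [hBpos, h2B] with q h1 h2
  have hBr : (0 : ℝ) < q.1 := by positivity
  rw [binomLoss_eq_stirlingSeq h1 (by omega), mul_right_comm 2, Real.sqrt_mul (by positivity)]
  simp only [Pi.div_apply, Function.comp]
  field_simp

/-! ### Nonasymptotic estimates for general sparsity -/

/-- The Gaussian bound crosses 1 at distance s = √(2 ln Δ/B) from the end of the horizon. Closer
rounds are charged 1 each; at distance s + u, (s + u)² ≥ s² + 2su bounds the term by a geometric
sequence of ratio exp(-Bs/T). Rounding and the first geometric term account for 2/T. -/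
theorem sum_min_exp_le {Δ B : ℝ} (hΔ : 1 < Δ) (hB : 0 < B) {T : ℕ} (hT : 0 < T) :
    (∑ t ∈ Finset.range T, min 1 (Δ * Real.exp (-(B * (1 - t / T) ^ 2 / 2)))) / T ≤
      √(2 * Real.log Δ / B) + 2 / T + 1 / (B * √(2 * Real.log Δ / B)) := by
  have hTr : (0 : ℝ) < T := by positivity
  have hl : 0 < Real.log Δ := Real.log_pos hΔ
  set s := √(2 * Real.log Δ / B) with hs
  have hs0 : 0 < s := Real.sqrt_pos.2 (by positivity)
  have hs2 : B * s ^ 2 / 2 = Real.log Δ := by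
    rw [hs, Real.sq_sqrt (by positivity)]
    field_simp
  set m := ⌈s * T⌉₊ with hm
  have hmle : (m : ℝ) ≤ s * T + 1 := (Nat.ceil_lt_add_one (by positivity)).le
  have hlem : s * T ≤ m := Nat.le_ceil _
  set y := B * s / T with hy
  have hy0 : 0 < y := by positivity
  have hr1 : Real.exp (-y) < 1 := by rwa [Real.exp_lt_one_iff, neg_lt_zero]
  have hr0 := Real.exp_pos (-y)
  -- Here i = T - 1 - t counts the rounds backwards from the end.
  have hterm : ∀ i ∈ Finset.range (m + T), i < T →
      min 1 (Δ * Real.exp (-(B * (1 - (T - 1 - i : ℕ) / T) ^ 2 / 2))) ≤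
        if i < m then 1 else Real.exp (-y) ^ (i - m) := by
    intro i _ hi
    split_ifs with h
    · exact min_le_left _ _
    · push Not at h
      refine (min_le_right _ _).trans ?_
      have e1 : (1 : ℝ) - (T - 1 - i : ℕ) / T = (i + 1) / T := by
        rw [Nat.cast_sub (by omega), Nat.cast_sub (by omega)]
        field_simp
        push_cast
        ring
      have hi' : (m : ℝ) ≤ i := by exact_mod_cast h
      have hz : ((i : ℝ) - m) / T + s ≤ (i + 1) / T := by
        rw [div_add' _ _ _ hTr.ne']
        exact div_le_div_of_nonneg_right (by linarith) hTr.le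
      rw [e1, ← Real.exp_nat_mul, Nat.cast_sub h, ← Real.exp_log (by linarith : 0 < Δ),
        ← Real.exp_add, Real.exp_le_exp, ← hs2]
      have hz0 : 0 ≤ ((i : ℝ) - m) / T := div_nonneg (by linarith) hTr.le
      have hsq : (((i : ℝ) - m) / T + s) ^ 2 ≤ ((i + 1 : ℝ) / T) ^ 2 := by gcongr
      have e2 : ((i : ℝ) - m) * -y = -(B * s * (((i : ℝ) - m) / T)) := by
        rw [hy]
        field_simp
      rw [e2]
      have := mul_le_mul_of_nonneg_left hsq hB.le
      have := mul_nonneg hB.le (sq_nonneg (((i : ℝ) - m) / T))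
      nlinarith
  have hgeom : ∑ i ∈ Finset.range T, Real.exp (-y) ^ i ≤ 1 + 1 / y := by
    have h1 : Real.exp (-y) ≤ 1 / (1 + y) := by
      rw [Real.exp_neg, ← one_div]
      exact one_div_le_one_div_of_le (by linarith) (by linarith [Real.add_one_le_exp y])
    calc _ ≤ (1 - Real.exp (-y))⁻¹ := by
          rw [← tsum_geometric_of_lt_one hr0.le hr1]
          exact (summable_geometric_of_lt_one hr0.le hr1).sum_le_tsum _ fun i _ => by positivity
      _ ≤ (1 - 1 / (1 + y))⁻¹ := by
          gcongr
          have : 1 / (1 + y) < 1 := by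
            rw [div_lt_one (by linarith)]
            linarith
          linarith
      _ = _ := by
          rw [one_sub_div (by linarith), add_sub_cancel_left, inv_div, add_div, div_self hy0.ne',
            add_comm]
  have hsum : ∑ t ∈ Finset.range T, min 1 (Δ * Real.exp (-(B * (1 - t / T) ^ 2 / 2))) ≤
      m + (1 + 1 / y) := by
    rw [← Finset.sum_range_reflect]
    calc _ ≤ ∑ i ∈ Finset.range T, (if i < m then 1 else Real.exp (-y) ^ (i - m)) :=
          Finset.sum_le_sum fun i hi => hterm i
            (Finset.mem_range.2 (by have := Finset.mem_range.1 hi; omega)) (Finset.mem_range.1 hi)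
      _ ≤ ∑ i ∈ Finset.range (m + T), (if i < m then 1 else Real.exp (-y) ^ (i - m)) :=
          Finset.sum_le_sum_of_subset_of_nonneg
            (Finset.range_subset_range.2 (by omega)) fun i _ _ => by positivity
      _ = m + ∑ i ∈ Finset.range T, Real.exp (-y) ^ i := by
          rw [Finset.sum_range_add]
          congr 1
          · rw [Finset.sum_congr rfl fun i hi => if_pos (Finset.mem_range.1 hi)]
            simp
          · exact Finset.sum_congr rfl fun i _ => by simp
      _ ≤ _ := by gcongr
  calc _ ≤ (s * T + 1 + (1 + 1 / y)) / T := by gcongr; linarith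
    _ = _ := by
        rw [hy]
        field_simp
        ring

/-- Tilting to q = (B + L)/m with L = 2√B, so that x = q/p - 1 is the relative excess. The exponent
is mB/T times x²/2 to leading order; the window width costs the term of order √B x, and B ≥ 16
ensures the variance condition 2(B + L) ≤ L². -/
theorem half_mul_exp_le_binomTail_div {B T m : ℕ} {x : ℝ} (hB : 16 ≤ B) (hT : 0 < T)
    (hp : (B : ℝ) / T ≤ 1 / 8) (hmT : m ≤ T) (hTm : T ≤ 2 * m)
    (hx : x = (1 + 2 / √B) * (T / m) - 1) (hx1 : x ≤ 1) :
    1 / 2 * Real.exp (-(B * x ^ 2 * (1 / 2 + x / 6 + 2 * (B / T)) + 4 * √B * x)) ≤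
      binomTail (B / T) m B := by
  have hBr : (16 : ℝ) ≤ B := by exact_mod_cast hB
  have hm : 0 < m := by omega
  have hTr : (0 : ℝ) < T := by positivity
  have hmr : (0 : ℝ) < m := by positivity
  have hmT' : (m : ℝ) ≤ T := by exact_mod_cast hmT
  have hTm' : (T : ℝ) ≤ 2 * m := by exact_mod_cast hTm
  set p : ℝ := B / T with hpdef
  have hp0 : 0 < p := by positivity
  have hs0 : 0 < √(B : ℝ) := Real.sqrt_pos.2 (by positivity)
  have hs2 : √(B : ℝ) * √B = B := Real.mul_self_sqrt (by positivity)
  have hs4 : 4 ≤ √(B : ℝ) := by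
    rw [Real.le_sqrt' (by norm_num)]
    linarith
  have hx0 : 0 ≤ x := by
    rw [hx]
    have h1 : 1 ≤ (T : ℝ) / m := (one_le_div hmr).2 hmT'
    have h2 : 0 ≤ 2 / √(B : ℝ) := by positivity
    nlinarith
  set L : ℝ := 2 * √B with hL
  set q : ℝ := p * (1 + x) with hq
  have hmq : m * q = B + L := by
    calc m * q = B + 2 * (B / √B) := by
          rw [hq, hx, hpdef]
          field_simp
          ring
      _ = B + L := by rw [hL, Real.div_sqrt]
  have hmp : m * p ≤ B := by
    rw [hpdef, mul_div_assoc', div_le_iff₀ hTr, mul_comm]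
    gcongr
  have hT8 : 8 * (B : ℝ) ≤ T := by
    rw [hpdef, div_le_iff₀ hTr] at hp
    linarith
  have hq1 : q < 1 := by nlinarith
  have hpq : p ≤ q := by nlinarith
  have hL0 : 0 < L := by positivity
  clear_value p L q
  refine le_trans ?_ (half_mul_exp_le_binomTail hp0 hpq hq1 hL0 hmq
    (by rw [hmq, hL]; nlinarith))
  refine mul_le_mul_of_nonneg_left (Real.exp_le_exp.2 (neg_le_neg ?_)) (by norm_num)
  have hqp : q / p = 1 + x := by
    rw [hq]
    field_simp
  have ha := Real.log_one_add_le hx0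
  have hb : Real.log ((1 - q) / (1 - p)) ≤ -(p * x / (1 - p)) := by
    refine (Real.log_le_sub_one_of_pos (div_pos (by linarith) (by linarith))).trans_eq ?_
    have : 1 - p ≠ 0 := by linarith
    rw [hq]
    field_simp
    ring
  rw [hqp]
  have hjm : 0 ≤ (m : ℝ) - (B + 2 * L) := by nlinarith
  have hj : 0 ≤ (B : ℝ) + 2 * L := by positivity
  have h1 := mul_le_mul_of_nonneg_left ha hj
  have h2 := mul_le_mul_of_nonneg_left hb hjm
  have hip : p * x / (1 - p) ≤ 2 * (p * x) := by
    rw [div_le_iff₀ (by linarith)]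
    have : 0 ≤ p * x := by positivity
    nlinarith
  have hpz : (1 - p) * (p * x / (1 - p)) = p * x := by
    have : 1 - p ≠ 0 := by linarith
    field_simp
  generalize p * x / (1 - p) = z at *
  have e1 : ((m : ℝ) - (B + 2 * L)) * -z = -(m * (p * x)) + (m * p * x + L) * z := by
    have : (B : ℝ) + 2 * L = m * q + L := by linarith
    rw [this, hq]
    linear_combination (-m : ℝ) * hpz
  -- With mq = mp(1 + x), the expansion (1 + x)(x - x²/2 + x³/3) = x + x²/2 - x³/6 + x⁴/3 shows that
  -- the first-order term mpx cancels against the one produced by the second logarithm.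
  have e2 : ((B : ℝ) + 2 * L) * (x - x ^ 2 / 2 + x ^ 3 / 3) - m * (p * x) =
      m * p * (x ^ 2 / 2 - x ^ 3 / 6 + x ^ 4 / 3) + L * (x - x ^ 2 / 2 + x ^ 3 / 3) := by
    have : (B : ℝ) + 2 * L = m * q + L := by linarith
    rw [this, hq]
    ring
  have i1 : m * p * (x ^ 2 / 2 - x ^ 3 / 6 + x ^ 4 / 3) ≤ B * (x ^ 2 * (1 / 2 + x / 6)) := by
    have : x ^ 4 ≤ x ^ 3 := pow_le_pow_of_le_one hx0 hx1 (by norm_num)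
    have h5 : 0 ≤ x ^ 2 * (1 / 2 + x / 6) := by positivity
    calc _ ≤ m * p * (x ^ 2 * (1 / 2 + x / 6)) := by
          gcongr
          linarith
      _ ≤ _ := by gcongr
  have i2 : L * (x - x ^ 2 / 2 + x ^ 3 / 3) ≤ L * x := by
    have : x ^ 3 ≤ x ^ 2 := pow_le_pow_of_le_one hx0 hx1 (by norm_num)
    gcongr
    linarith [sq_nonneg x]
  have i3 : (m * p * x + L) * z ≤ (B * x + L) * (2 * (p * x)) := by
    have : 0 ≤ m * p * x + L := by positivity
    calc _ ≤ (m * p * x + L) * (2 * (p * x)) := by gcongr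
      _ ≤ _ := by gcongr
  have i4 : L * (2 * (p * x)) ≤ L * x := by
    gcongr
    have := mul_le_mul_of_nonneg_right hp hx0
    linarith
  have : 4 * √(B : ℝ) * x = 2 * (L * x) := by rw [hL]; ring
  rw [this]
  linarith

/-! ### Asymptotics in the regime of general sparsity -/

namespace MBOSM

theorem tendsto_regimeGeneral_log :
    Tendsto (fun q : ℕ × ℕ × ℕ => Real.log q.1) regimeGeneral atTop :=
  tendsto_comap.mono_left (inf_le_left.trans inf_le_left)

theorem tendsto_regimeGeneral_budget :
    Tendsto (fun q : ℕ × ℕ × ℕ => (q.2.1 : ℝ) / Real.log q.1) regimeGeneral atTop :=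
  tendsto_comap.mono_left (inf_le_left.trans inf_le_right)

theorem tendsto_regimeGeneral_horizon :
    Tendsto (fun q : ℕ × ℕ × ℕ => (q.2.2 : ℝ) / q.2.1) regimeGeneral atTop :=
  tendsto_comap.mono_left inf_le_right

theorem tendsto_regimeGeneral_fst : Tendsto (fun q : ℕ × ℕ × ℕ => q.2.1) regimeGeneral atTop := by
  rw [← tendsto_natCast_atTop_iff (R := ℝ)]
  refine (tendsto_regimeGeneral_log.atTop_mul_atTop₀ tendsto_regimeGeneral_budget).congr' ?_
  filter_upwards [tendsto_regimeGeneral_log.eventually_gt_atTop 0] with q hq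
  field_simp

theorem eventually_regimeGeneral : ∀ᶠ q in regimeGeneral,
    0 < Real.log q.1 ∧ 16 ≤ q.2.1 ∧ 8 * q.2.1 ≤ q.2.2 := by
  filter_upwards [tendsto_regimeGeneral_log.eventually_gt_atTop 0,
    tendsto_regimeGeneral_fst.eventually_ge_atTop 16,
    tendsto_regimeGeneral_horizon.eventually_ge_atTop 8] with q h1 h2 h3
  refine ⟨h1, h2, ?_⟩
  have : (0 : ℝ) < q.2.1 := by exact_mod_cast (by omega : 0 < q.2.1)
  rw [le_div_iff₀ this] at h3
  exact_mod_cast h3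

/-- The relative loss of the sampling algorithm for general sparsity. -/
noncomputable def lossScale (q : ℕ × ℕ × ℕ) : ℝ := √(2 * Real.log q.1 / q.2.1)

theorem tendsto_lossScale : Tendsto lossScale regimeGeneral (𝓝 0) := by
  have := (tendsto_regimeGeneral_budget.inv_tendsto_atTop.const_mul 2).sqrt
  rw [mul_zero, Real.sqrt_zero] at this
  refine this.congr fun q => ?_
  simp [lossScale, mul_div_assoc]

theorem lossScale_pos : ∀ᶠ q in regimeGeneral, 0 < lossScale q := by
  filter_upwards [eventually_regimeGeneral] with q hq
  have : (0 : ℝ) < q.2.1 := by exact_mod_cast (by omega : 0 < q.2.1)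
  have := hq.1
  exact Real.sqrt_pos.2 (by positivity)

theorem tendsto_budget_mul_lossScale :
    Tendsto (fun q : ℕ × ℕ × ℕ => q.2.1 * lossScale q ^ 2) regimeGeneral atTop := by
  refine (tendsto_regimeGeneral_log.const_mul_atTop (by norm_num : (0 : ℝ) < 2)).congr' ?_
  filter_upwards [eventually_regimeGeneral] with q hq
  have : (0 : ℝ) < q.2.1 := by exact_mod_cast (by omega : 0 < q.2.1)
  have := hq.1
  rw [lossScale, Real.sq_sqrt (by positivity)]
  field_simp

/-- As B ≤ T and the scale s is at most 1, Ts dominates Bs² = 2 ln Δ. This makes the rounding of one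
round negligible. -/
theorem tendsto_inv_horizon_mul_lossScale :
    Tendsto (fun q : ℕ × ℕ × ℕ => 1 / (q.2.2 * lossScale q)) regimeGeneral (𝓝 0) := by
  simp_rw [one_div]
  refine Tendsto.inv_tendsto_atTop ?_
  refine tendsto_atTop_mono' _ ?_ tendsto_budget_mul_lossScale
  filter_upwards [eventually_regimeGeneral, lossScale_pos,
    tendsto_lossScale.eventually_le_const one_pos] with q hq h0 h1
  have : (q.2.1 : ℝ) ≤ q.2.2 := by exact_mod_cast (by omega : q.2.1 ≤ q.2.2)
  have : lossScale q ^ 2 ≤ lossScale q := by nlinarith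
  gcongr

/-- The first round of the final phase of the horizon. -/
noncomputable def phaseStart (c : ℝ) (q : ℕ × ℕ × ℕ) : ℕ := ⌈(1 - c * lossScale q) * q.2.2⌉₊

/-- At distance cs from the end the tail exponent is about B(cs)²/2 = c² ln Δ, so the product
behaves like Δ^(1 - c²). The condition c < 1 is what makes it diverge. -/
theorem tendsto_mul_binomTail {c : ℝ} (hc0 : 0 < c) (hc1 : c < 1) :
    Tendsto (fun q : ℕ × ℕ × ℕ => q.1 * binomTail (q.2.1 / q.2.2) (phaseStart c q) q.2.1)
      regimeGeneral atTop := by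
  -- X dominates the relative excess x at the rounded start of the phase. Y is X divided by the
  -- scale s and tends to c, because 2/√B = s √2/√(ln Δ) is negligible against s.
  let X : ℕ × ℕ × ℕ → ℝ := fun q => (1 + 2 / √q.2.1) / (1 - c * lossScale q) - 1
  let Y : ℕ × ℕ × ℕ → ℝ := fun q => (√2 / √(Real.log q.1) + c) / (1 - c * lossScale q)
  have hs := tendsto_lossScale
  have hu : Tendsto (fun q => 1 - c * lossScale q) regimeGeneral (𝓝 1) := by
    simpa using (hs.const_mul c).const_sub 1
  have hY : Tendsto Y regimeGeneral (𝓝 c) := by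
    have h1 : Tendsto (fun q : ℕ × ℕ × ℕ => √2 / √(Real.log q.1)) regimeGeneral (𝓝 0) :=
      (Real.tendsto_sqrt_atTop.comp tendsto_regimeGeneral_log).const_div_atTop _
    have h2 := (h1.add_const c).div hu one_ne_zero
    rwa [zero_add, div_one] at h2
  have hX : Tendsto X regimeGeneral (𝓝 0) := by
    have h1 : Tendsto (fun q : ℕ × ℕ × ℕ => 2 / √(q.2.1 : ℝ)) regimeGeneral (𝓝 0) :=
      (Real.tendsto_sqrt_atTop.comp
        (tendsto_natCast_atTop_atTop.comp tendsto_regimeGeneral_fst)).const_div_atTop _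
    simpa using ((h1.const_add 1).div hu one_ne_zero).sub_const 1
  have hXY : ∀ᶠ q in regimeGeneral, X q = Y q * lossScale q := by
    filter_upwards [eventually_regimeGeneral, hu.eventually_const_lt zero_lt_one] with q hq h1
    have hB : (0 : ℝ) < q.2.1 := by exact_mod_cast (by omega : 0 < q.2.1)
    have hl := Real.sqrt_pos.2 hq.1
    have h2 : √2 / √(Real.log q.1) * lossScale q = 2 / √(q.2.1 : ℝ) := by
      rw [lossScale, mul_div_assoc, Real.sqrt_mul (by norm_num), Real.sqrt_div hq.1.le]
      field_simp
      norm_num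
    simp only [X, Y]
    rw [div_mul_eq_mul_div, add_mul, h2, div_sub_one h1.ne']
    congr 1
    ring
  -- The tilting exponent, bounded through X and divided by ln Δ.
  let r : ℕ × ℕ × ℕ → ℝ := fun q =>
    2 * Y q ^ 2 * (1 / 2 + X q / 6 + 2 * (q.2.1 / q.2.2)) + 4 * √2 * Y q / √(Real.log q.1)
  have hr : Tendsto r regimeGeneral (𝓝 (c ^ 2)) := by
    have h1 : Tendsto (fun q : ℕ × ℕ × ℕ => (q.2.1 : ℝ) / q.2.2) regimeGeneral (𝓝 0) :=
      tendsto_regimeGeneral_horizon.inv_tendsto_atTop.congr fun q => by simp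
    have h2 : Tendsto (fun q : ℕ × ℕ × ℕ => 4 * √2 * Y q / √(Real.log q.1)) regimeGeneral (𝓝 0) :=
      (hY.const_mul _).div_atTop (Real.tendsto_sqrt_atTop.comp tendsto_regimeGeneral_log)
    have h3 := ((hY.pow 2).const_mul 2).mul
      (((hX.div_const 6).const_add (1 / 2)).add (h1.const_mul 2)) |>.add h2
    convert h3 using 2
    ring
  have hlim : Tendsto (fun q : ℕ × ℕ × ℕ => 1 / 2 * Real.exp (Real.log q.1 * (1 - r q)))
      regimeGeneral atTop := by
    refine (Real.tendsto_exp_atTop.comp ?_).const_mul_atTop (by norm_num)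
    exact tendsto_regimeGeneral_log.atTop_mul_pos (by nlinarith : 0 < 1 - c ^ 2) (hr.const_sub 1)
  refine tendsto_atTop_mono' _ ?_ hlim
  filter_upwards [eventually_regimeGeneral, hu.eventually_const_lt (by norm_num : (1 / 2 : ℝ) < 1),
    hX.eventually_le_const one_pos, hXY, lossScale_pos] with q hq h1 h2 h3 h4
  obtain ⟨hl, hB16, hTB⟩ := hq
  have hB : (0 : ℝ) < q.2.1 := by exact_mod_cast (by omega : 0 < q.2.1)
  have hTn : 0 < q.2.2 := by omega
  have hT : (0 : ℝ) < q.2.2 := by exact_mod_cast hTn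
  have hΔ : (0 : ℝ) < q.1 := by
    rcases Nat.eq_zero_or_pos q.1 with h | h
    · simp [h] at hl
    · exact_mod_cast h
  have hm : (1 - c * lossScale q) * q.2.2 ≤ phaseStart c q := Nat.le_ceil _
  have hmT : phaseStart c q ≤ q.2.2 := by
    refine Nat.ceil_le.2 (mul_le_of_le_one_left hT.le ?_)
    have : 0 ≤ c * lossScale q := by positivity
    linarith
  have hTm : q.2.2 ≤ 2 * phaseStart c q := by
    have : (q.2.2 : ℝ) ≤ 2 * phaseStart c q := by nlinarith
    exact_mod_cast this
  have hmr : (0 : ℝ) < phaseStart c q := by exact_mod_cast (by omega : 0 < phaseStart c q)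
  set x : ℝ := (1 + 2 / √q.2.1) * (q.2.2 / phaseStart c q) - 1 with hx
  have hxX : x ≤ X q := by
    simp only [hx, X]
    rw [div_eq_mul_inv (1 + 2 / √(q.2.1 : ℝ))]
    gcongr
    rw [div_le_iff₀ hmr, ← div_eq_inv_mul, le_div_iff₀ (by linarith)]
    linarith
  have hx0 : 0 ≤ x := by
    have h5 : 1 ≤ (q.2.2 : ℝ) / phaseStart c q := (one_le_div hmr).2 (by exact_mod_cast hmT)
    have h6 : 0 ≤ 2 / √(q.2.1 : ℝ) := by positivity
    rw [hx]
    nlinarith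
  have hp8 : (q.2.1 : ℝ) / q.2.2 ≤ 1 / 8 := by
    rw [div_le_iff₀ hT]
    have : (8 : ℝ) * q.2.1 ≤ q.2.2 := by exact_mod_cast hTB
    linarith
  have key := half_mul_exp_le_binomTail_div hB16 hTn hp8 hmT hTm hx (hxX.trans h2)
  have hE : q.2.1 * x ^ 2 * (1 / 2 + x / 6 + 2 * (q.2.1 / q.2.2)) + 4 * √q.2.1 * x ≤
      Real.log q.1 * r q := by
    calc _ ≤ q.2.1 * X q ^ 2 * (1 / 2 + X q / 6 + 2 * (q.2.1 / q.2.2)) + 4 * √q.2.1 * X q := by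
          gcongr
      _ = _ := by
          have e1 : q.2.1 * X q ^ 2 = Real.log q.1 * (2 * Y q ^ 2) := by
            rw [h3, mul_pow, lossScale, Real.sq_sqrt (by positivity)]
            field_simp
          have e2 : √q.2.1 * X q = Real.log q.1 * (√2 * Y q / √(Real.log q.1)) := by
            have hl' := Real.sqrt_pos.2 hl
            have hB' := Real.sqrt_pos.2 hB
            rw [h3, lossScale, mul_div_assoc, Real.sqrt_mul (by norm_num), Real.sqrt_div hl.le]
            nth_rw 2 [← Real.mul_self_sqrt hl.le]
            field_simp
          rw [e1, mul_assoc 4, e2]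
          simp only [r]
          ring
  calc _ = q.1 * (1 / 2 * Real.exp (-(Real.log q.1 * r q))) := by
        rw [mul_one_sub, sub_eq_add_neg, Real.exp_add, Real.exp_log hΔ]
        ring
    _ ≤ q.1 * binomTail (q.2.1 / q.2.2) (phaseStart c q) q.2.1 := by
        gcongr
        refine le_trans ?_ key
        gcongr

/-- Before the final phase terms are bounded by 1; within it, (1 - tail)^Δ ≤ exp(-Δ tail) ≤ η, by
monotonicity of the tail in the number of trials. -/
theorem eventually_sum_one_sub_binomTail_pow_le {η : ℝ} (hη0 : 0 < η) (hη1 : η < 1) :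
    ∀ᶠ q : ℕ × ℕ × ℕ in regimeGeneral,
      (∑ t ∈ Finset.range q.2.2, (1 - binomTail (q.2.1 / q.2.2) t q.2.1) ^ q.1) / q.2.2 ≤
        1 - (1 - 3 * η) * lossScale q := by
  have hlim := tendsto_mul_binomTail (c := 1 - η) (by linarith) (by linarith)
  have hexp : ∀ᶠ q : ℕ × ℕ × ℕ in regimeGeneral, Real.exp (-(q.1 * binomTail (q.2.1 / q.2.2)
      (phaseStart (1 - η) q) q.2.1)) ≤ η :=
    (Real.tendsto_exp_neg_atTop_nhds_zero.comp hlim).eventually_le_const hη0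
  filter_upwards [eventually_regimeGeneral, hexp, lossScale_pos,
    tendsto_lossScale.eventually_le_const one_pos,
    tendsto_inv_horizon_mul_lossScale.eventually_le_const hη0] with q hq h1 h2 h2' h3
  obtain ⟨hl, hB16, hTB⟩ := hq
  have hT : (0 : ℝ) < q.2.2 := by exact_mod_cast (by omega : 0 < q.2.2)
  set p : ℝ := q.2.1 / q.2.2 with hp
  have hp0 : 0 ≤ p := by positivity
  have hp1 : p ≤ 1 := by
    rw [hp, div_le_one hT]
    exact_mod_cast (by omega : q.2.1 ≤ q.2.2)
  set m := phaseStart (1 - η) q with hm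
  have hmT : m ≤ q.2.2 := by
    refine Nat.ceil_le.2 (mul_le_of_le_one_left hT.le ?_)
    have : 0 ≤ (1 - η) * lossScale q := mul_nonneg (by linarith) h2.le
    linarith
  have hm1 : (m : ℝ) ≤ (1 - (1 - η) * lossScale q) * q.2.2 + 1 :=
    (Nat.ceil_lt_add_one (mul_nonneg (by nlinarith) hT.le)).le
  have hterm : ∀ t ∈ Finset.range q.2.2, (1 - binomTail p t q.2.1) ^ q.1 ≤
      if t < m then 1 else η := by
    intro t _
    have ht0 : 0 ≤ 1 - binomTail p t q.2.1 := by linarith [binomTail_le_one hp0 hp1 t q.2.1]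
    split_ifs with h
    · exact pow_le_one₀ ht0 (by linarith [binomTail_nonneg hp0 hp1 t q.2.1])
    · refine le_trans ?_ h1
      have h5 := binomTail_mono_left hp0 hp1 q.2.1 (not_lt.1 h)
      dsimp only at h5
      calc _ ≤ Real.exp (-binomTail p m q.2.1) ^ q.1 := by
            gcongr
            linarith [Real.add_one_le_exp (-binomTail p m q.2.1)]
        _ = _ := by rw [← Real.exp_nat_mul, mul_neg]
  have hsum : ∑ t ∈ Finset.range q.2.2, (1 - binomTail p t q.2.1) ^ q.1 ≤
      m + (q.2.2 - m) * η := by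
    refine (Finset.sum_le_sum hterm).trans_eq ?_
    obtain ⟨d, hd⟩ := Nat.exists_eq_add_of_le hmT
    rw [hd, Finset.sum_range_add, Finset.sum_congr rfl fun i hi => if_pos (Finset.mem_range.1 hi)]
    simp
  rw [div_le_iff₀ hT]
  refine hsum.trans ?_
  rw [div_le_iff₀ (by positivity)] at h3
  -- The three losses of η come from starting the phase at 1 - (1 - η)s, from rounding that start
  -- up, and from the residual value η of each term: (1 - 2η)(1 - η) ≥ 1 - 3η.
  have h6 : (q.2.2 - m) * (1 - η) ≥ ((1 - 2 * η) * lossScale q * q.2.2) * (1 - η) := by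
    refine mul_le_mul_of_nonneg_right ?_ (by linarith)
    linarith
  have h7 : 0 < lossScale q * q.2.2 := by positivity
  nlinarith

end MBOSM

/-! ### Histories of a policy and averages over arrivals -/

namespace MBOSM

variable {I : MBOSM}

theorem sum_decision {M : Type*} [AddCommMonoid M] (f : I.Decision → M) :
    ∑ d, f d = f (none : Option I.Edge) + ∑ e : I.Edge, f (some e : Option I.Edge) :=
  Fintype.sum_option (α := I.Edge) _

theorem measurable_snoc (n : ℕ) : Measurable fun q : (Fin n → I.Outcome) × I.Outcome =>
    Fin.snoc (α := fun _ => I.Outcome) q.1 q.2 := by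
  refine measurable_pi_lambda _ fun i => ?_
  refine Fin.lastCases ?_ (fun j => ?_) i
  · simpa using measurable_snd
  · simp only [Fin.snoc_castSucc]
    exact (measurable_pi_apply j).comp measurable_fst

theorem sum_snoc {M : Type*} [AddCommMonoid M] {n : ℕ} (g : I.Outcome → M)
    (h : Fin n → I.Outcome) (o : I.Outcome) :
    ∑ s, g (Fin.snoc (α := fun _ => I.Outcome) h o s) = ∑ s, g (h s) + g o := by
  simp [Fin.sum_univ_castSucc]

theorem consumed_eq_sum {n : ℕ} (h : Fin n → I.Outcome) (k : Fin I.K) :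
    I.consumed h k = ∑ s, if (h s).2.1 k = true then 1 else 0 := by
  rw [consumed, Finset.card_filter]

theorem consumed_snoc {n : ℕ} (h : Fin n → I.Outcome) (o : I.Outcome) (k : Fin I.K) :
    I.consumed (Fin.snoc (α := fun _ => I.Outcome) h o) k =
      I.consumed h k + if o.2.1 k = true then 1 else 0 := by
  rw [consumed_eq_sum, consumed_eq_sum, sum_snoc fun o : I.Outcome => if o.2.1 k = true then 1 else 0]

theorem measurableSet_consume (k : Fin I.K) :
    MeasurableSet {z : (Fin I.K → Bool) × ℝ≥0 | z.1 k = true} :=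
  measurableSet_eq_fun ((measurable_pi_apply k).comp measurable_fst) measurable_const

theorem measurable_consumed (n : ℕ) (k : Fin I.K) :
    Measurable fun h : Fin n → I.Outcome => I.consumed h k := by
  simp_rw [consumed_eq_sum]
  refine Finset.measurable_sum _ fun s _ => Measurable.ite ?_ measurable_const measurable_const
  exact (measurableSet_consume k).preimage (measurable_snd.comp (measurable_pi_apply s))

instance (e : I.Edge) : IsProbabilityMeasure (I.law e) := I.law_prob e

theorem law_consume (e : I.Edge) (k : Fin I.K) :
    I.law e {z | z.1 k = true} = ENNReal.ofReal (I.meanCost e k) :=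
  (ofReal_measureReal (measure_ne_top _ _)).symm

theorem meanCost_nonneg (e : I.Edge) (k : Fin I.K) : 0 ≤ I.meanCost e k := measureReal_nonneg

theorem mem_support {e : I.Edge} {k : Fin I.K} : k ∈ I.support e ↔ 0 < I.meanCost e k := by
  simp [support]

namespace Policy

variable (π : I.Policy) (a : Fin I.T → Fin I.nJ)

theorem lintegral_kernel {n : ℕ} (hn : n < I.T) (h : Fin n → I.Outcome) {g : I.Outcome → ℝ≥0∞}
    (hg : Measurable g) :
    ∫⁻ o, g o ∂π.kernel a n hn h =
      ∑ d, ENNReal.ofReal (π.prob a n hn h d) * ∫⁻ z, g (d, z) ∂I.realizationLaw d := by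
  change ∫⁻ o, g o ∂(∑ d, ENNReal.ofReal (π.prob a n hn h d) •
    (I.realizationLaw d).map (fun z => (d, z))) = _
  rw [lintegral_finsetSum_measure]
  refine Finset.sum_congr rfl fun d _ => ?_
  rw [lintegral_smul_measure, lintegral_map hg measurable_prodMk_left, smul_eq_mul]

theorem lintegral_kernel_of_none {n : ℕ} (hn : n < I.T) (h : Fin n → I.Outcome)
    {g : I.Outcome → ℝ≥0∞} (hg : Measurable g)
    (h0 : g ((none : Option I.Edge), (fun _ => false, 0)) = 0) :
    ∫⁻ o, g o ∂π.kernel a n hn h = ∑ e : I.Edge, ENNReal.ofReal (π.prob a n hn h (some e)) *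
      ∫⁻ z, g ((some e : Option I.Edge), z) ∂I.law e := by
  rw [lintegral_kernel π a hn h hg, sum_decision]
  have : ∫⁻ z, g ((none : Option I.Edge), z) ∂I.realizationLaw (none : Option I.Edge) = 0 := by
    change ∫⁻ z, g ((none : Option I.Edge), z) ∂(Measure.dirac (fun _ => false, 0)) = 0
    exact (lintegral_dirac' _ (hg.comp measurable_prodMk_left)).trans h0
  rw [this, mul_zero, zero_add]
  rfl

theorem lintegral_historyLaw_succ {n : ℕ} (hn : n < I.T) {f : (Fin (n + 1) → I.Outcome) → ℝ≥0∞}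
    (hf : Measurable f) :
    ∫⁻ h, f h ∂π.historyLaw a (n + 1) hn =
      ∫⁻ h, ∫⁻ o, f (Fin.snoc (α := fun _ => I.Outcome) h o) ∂π.kernel a n hn h
        ∂π.historyLaw a n hn.le := by
  have := π.historyLaw_isProbability a n hn.le
  change ∫⁻ h, f h ∂((π.historyLaw a n _ ⊗ₘ π.kernel a n hn).map
      fun q => Fin.snoc (α := fun _ => I.Outcome) q.1 q.2) = _
  rw [lintegral_map hf (measurable_snoc n)]
  exact Measure.lintegral_compProd (hf.comp (measurable_snoc n))

theorem measurable_lintegral_kernel {n : ℕ} (hn : n < I.T)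
    {f : (Fin n → I.Outcome) → I.Outcome → ℝ≥0∞} (hf : Measurable (Function.uncurry f)) :
    Measurable fun h => ∫⁻ o, f h o ∂π.kernel a n hn h :=
  Measurable.lintegral_kernel_prod_right hf

/-- The tower property: an expected total over the rounds is the sum of the expectations of its
conditional increments. -/
theorem lintegral_sum_historyLaw {g : I.Outcome → ℝ≥0∞} (hg : Measurable g) (n : ℕ)
    (hn : n ≤ I.T) :
    ∫⁻ h, ∑ s, g (h s) ∂π.historyLaw a n hn =
      ∑ t : Fin n, ∫⁻ h, ∫⁻ o, g o ∂π.kernel a t (t.2.trans_le hn) h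
        ∂π.historyLaw a t (t.2.trans_le hn).le := by
  induction n with
  | zero => simp
  | succ n ih =>
    have hm : ∀ m, Measurable fun h : Fin m → I.Outcome => ∑ s, g (h s) := fun m =>
      Finset.measurable_sum _ fun s _ => hg.comp (measurable_pi_apply s)
    rw [lintegral_historyLaw_succ π a hn (hm _), Fin.sum_univ_castSucc]
    simp_rw [sum_snoc]
    simp only [Fin.val_castSucc, Fin.val_last]
    rw [← ih (Nat.le_of_succ_le hn), ← lintegral_add_left (hm _)]
    refine lintegral_congr fun h => ?_
    rw [lintegral_add_left measurable_const, lintegral_const, measure_univ, mul_one]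

/-- A potential that decreases in expectation in every round is bounded by its initial value. -/
theorem lintegral_historyLaw_le {f : (n : ℕ) → (Fin n → I.Outcome) → ℝ≥0∞}
    (hf : ∀ n, Measurable (f n))
    (hstep : ∀ n (hn : n < I.T) h,
      ∫⁻ o, f (n + 1) (Fin.snoc (α := fun _ => I.Outcome) h o) ∂π.kernel a n hn h ≤ f n h)
    (n : ℕ) (hn : n ≤ I.T) : ∫⁻ h, f n h ∂π.historyLaw a n hn ≤ f 0 Fin.elim0 := by
  induction n with
  | zero =>
    change ∫⁻ h, f 0 h ∂(Measure.dirac Fin.elim0) ≤ _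
    rw [lintegral_dirac' _ (hf 0)]
  | succ n ih =>
    rw [lintegral_historyLaw_succ π a hn (hf _)]
    exact (lintegral_mono fun h => hstep n hn h).trans (ih _)

open Classical in
/-- If outcomes in `S` have probability zero as soon as `c` of them have been observed, then their
expected number is at most `c`. -/
theorem sum_lintegral_kernel_le {S : Set I.Outcome} (hS : MeasurableSet S) (c : ℕ)
    (hcap : ∀ n (hn : n < I.T) (h : Fin n → I.Outcome),
      c ≤ (∑ s, if h s ∈ S then 1 else 0) → π.kernel a n hn h S = 0) :
    ∑ t : Fin I.T, ∫⁻ h, π.kernel a t t.2 h S ∂π.historyLaw a t t.2.le ≤ c := by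
  let cnt : (n : ℕ) → (Fin n → I.Outcome) → ℕ := fun n h => ∑ s, if h s ∈ S then 1 else 0
  have hm : ∀ n, Measurable (cnt n) := fun n =>
    Finset.measurable_sum _ fun s _ => Measurable.ite (hS.preimage (measurable_pi_apply s))
      measurable_const measurable_const
  have hm' : ∀ n, Measurable fun h => ((min (cnt n h) c : ℕ) : ℝ≥0∞) := fun n =>
    (measurable_of_countable fun j : ℕ => ((min j c : ℕ) : ℝ≥0∞)).comp (hm n)
  -- The count truncated at c is the potential: below c an outcome in S raises it by one, and at c
  -- the hypothesis makes such outcomes null, so no increment is missed.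
  have key : ∀ n (hn : n ≤ I.T), ∑ t : Fin n, ∫⁻ h, π.kernel a t (t.2.trans_le hn) h S
      ∂π.historyLaw a t (t.2.trans_le hn).le ≤
        ∫⁻ h, ((min (cnt n h) c : ℕ) : ℝ≥0∞) ∂π.historyLaw a n hn := by
    intro n
    induction n with
    | zero => simp
    | succ n ih =>
      intro hn
      rw [Fin.sum_univ_castSucc, lintegral_historyLaw_succ π a hn (hm' _)]
      refine (add_le_add_left (ih (Nat.le_of_succ_le hn)) _).trans ?_
      change ∫⁻ h, ((min (cnt n h) c : ℕ) : ℝ≥0∞) ∂π.historyLaw a n _ +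
        ∫⁻ h, π.kernel a n hn h S ∂π.historyLaw a n _ ≤ _
      rw [← lintegral_add_left (hm' n)]
      refine lintegral_mono fun h => ?_
      have hcnt : ∀ o, cnt (n + 1) (Fin.snoc (α := fun _ => I.Outcome) h o) =
          cnt n h + if o ∈ S then 1 else 0 := fun o =>
        sum_snoc (fun o => if o ∈ S then 1 else 0) h o
      rcases le_or_gt c (cnt n h) with hc | hc
      · rw [hcap n hn h hc, add_zero, min_eq_right hc]
        calc (c : ℝ≥0∞) = ∫⁻ _, c ∂π.kernel a n hn h := by simp
          _ ≤ _ := lintegral_mono fun o => by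
            rw [hcnt, min_eq_right (hc.trans (Nat.le_add_right _ _))]
      · calc ((min (cnt n h) c : ℕ) : ℝ≥0∞) + π.kernel a n hn h S =
            ∫⁻ o, ((min (cnt n h) c : ℕ) : ℝ≥0∞) + S.indicator 1 o ∂π.kernel a n hn h := by
              rw [lintegral_add_left measurable_const, lintegral_indicator_one hS]
              simp
          _ ≤ _ := lintegral_mono fun o => by
            rw [hcnt, min_eq_left hc.le]
            by_cases ho : o ∈ S
            · simp only [ho, if_true, Set.indicator_of_mem, Pi.one_apply]
              rw [min_eq_left (Nat.succ_le_of_lt hc)]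
              push_cast
              rfl
            · simp [ho, hc.le]
  refine (key I.T le_rfl).trans ?_
  have := π.historyLaw_isProbability a I.T le_rfl
  refine (lintegral_mono fun h => Nat.cast_le.2 (min_le_right _ _)).trans ?_
  simp

/-- Expected number of additions of the edge `e` when the arrival sequence is `a`. -/
noncomputable def adds (e : I.Edge) : ℝ≥0∞ :=
  ∑ t : Fin I.T, ∫⁻ h, ENNReal.ofReal (π.prob a t t.2 h (some e)) ∂π.historyLaw a t t.2.le

theorem measurable_ofReal_prob {n : ℕ} (hn : n < I.T) (d : I.Decision) :
    Measurable fun h => ENNReal.ofReal (π.prob a n hn h d) :=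
  (π.measurable a n hn d).ennreal_ofReal

/-- Expected total of a quantity that vanishes in the rounds with a rejection. -/
theorem sum_lintegral_lintegral_kernel {g : I.Outcome → ℝ≥0∞} (hg : Measurable g)
    (h0 : g ((none : Option I.Edge), (fun _ => false, 0)) = 0) :
    ∑ t : Fin I.T, ∫⁻ h, ∫⁻ o, g o ∂π.kernel a t t.2 h ∂π.historyLaw a t t.2.le =
      ∑ e : I.Edge, π.adds a e * ∫⁻ z, g ((some e : Option I.Edge), z) ∂I.law e := by
  simp_rw [lintegral_kernel_of_none π a _ _ hg h0, adds, Finset.sum_mul]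
  rw [Finset.sum_comm]
  refine Finset.sum_congr rfl fun t _ => ?_
  refine (lintegral_finsetSum _ fun e _ =>
    (π.measurable_ofReal_prob a t.2 _).mul_const _).trans ?_
  exact Finset.sum_congr rfl fun e _ =>
    lintegral_mul_const _ (π.measurable_ofReal_prob a t.2 _)

/-- Average over the random arrival sequence. -/
noncomputable def _root_.MBOSM.arrivalAvg (I : MBOSM) (g : (Fin I.T → Fin I.nJ) → ℝ≥0∞) : ℝ≥0∞ :=
  ∑ a, (∏ t, (I.p (a t) : ℝ≥0∞)) * g a

/-- A Wald identity: realizations are fresh, hence independent of the decision to add the edge, and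
the value is linear in the expected numbers of additions. -/
theorem value_eq : π.value = ∑ e : I.Edge,
    I.arrivalAvg (fun a => π.adds a e) * ∫⁻ z, (z.2 : ℝ≥0∞) ∂I.law e := by
  have hg : Measurable fun o : I.Outcome => (o.2.2 : ℝ≥0∞) :=
    (measurable_snd.comp measurable_snd).coe_nnreal_ennreal
  unfold value arrivalAvg
  simp_rw [Finset.sum_mul]
  rw [Finset.sum_comm]
  refine Finset.sum_congr rfl fun a _ => ?_
  rw [lintegral_sum_historyLaw π a hg, sum_lintegral_lintegral_kernel π a hg (by simp),
    Finset.mul_sum]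
  exact Finset.sum_congr rfl fun e _ => (mul_assoc _ _ _).symm

end Policy

/-- Resampling the arrival of one round does not change averages over the arrival sequence. -/
theorem arrivalAvg_update (I : MBOSM) (g : (Fin I.T → Fin I.nJ) → ℝ≥0∞) (t : Fin I.T) :
    I.arrivalAvg g = I.arrivalAvg fun a => ∑ j, (I.p j : ℝ≥0∞) * g (Function.update a t j) := by
  have hp : ∑ j, (I.p j : ℝ≥0∞) = 1 := by
    rw [← ENNReal.ofNNReal_finsetSum, I.p_sum, ENNReal.coe_one]
  have hw : ∀ (a : Fin I.T → Fin I.nJ) j, (∏ s, (I.p (Function.update a t j s) : ℝ≥0∞)) *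
      I.p (a t) = (∏ s, (I.p (a s) : ℝ≥0∞)) * I.p j := by
    intro a j
    rw [← Finset.mul_prod_erase _ _ (Finset.mem_univ t),
      ← Finset.mul_prod_erase _ (fun s => (I.p (a s) : ℝ≥0∞)) (Finset.mem_univ t),
      Finset.prod_congr rfl fun s hs => by
        rw [Function.update_of_ne (Finset.ne_of_mem_erase hs)], Function.update_self]
    ring
  calc I.arrivalAvg g = ∑ a, ∑ j, (∏ s, (I.p (a s) : ℝ≥0∞)) * I.p j * g a := by
        refine Finset.sum_congr rfl fun a _ => ?_
        rw [← Finset.sum_mul, ← Finset.mul_sum, hp, mul_one]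
    _ = ∑ x : (Fin I.T → Fin I.nJ) × Fin I.nJ,
          (∏ s, (I.p (x.1 s) : ℝ≥0∞)) * I.p x.2 * g x.1 :=
        (Fintype.sum_prod_type' fun a j => (∏ s, (I.p (a s) : ℝ≥0∞)) * I.p j * g a).symm
    _ = ∑ x : (Fin I.T → Fin I.nJ) × Fin I.nJ,
          (∏ s, (I.p (x.1 s) : ℝ≥0∞)) * I.p x.2 * g (Function.update x.1 t x.2) := by
        -- Swapping the arrival of round t with the fresh sample j is an involution that preserves
        -- the product weight.
        refine Finset.sum_nbij' (fun x => (Function.update x.1 t x.2, x.1 t))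
          (fun x => (Function.update x.1 t x.2, x.1 t)) (by simp) (by simp) (by simp) (by simp) ?_
        rintro ⟨a, j⟩ -
        simp only [hw, Function.update_idem, Function.update_eq_self]
    _ = _ := by
        rw [Fintype.sum_prod_type]
        refine Finset.sum_congr rfl fun a _ => ?_
        simp_rw [Finset.mul_sum, mul_assoc]

theorem arrivalAvg_mono (I : MBOSM) {f g : (Fin I.T → Fin I.nJ) → ℝ≥0∞} (h : ∀ a, f a ≤ g a) :
    I.arrivalAvg f ≤ I.arrivalAvg g :=
  Finset.sum_le_sum fun a _ => by gcongr; exact h a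

theorem arrivalAvg_const (I : MBOSM) (c : ℝ≥0∞) : I.arrivalAvg (fun _ => c) = c := by
  have hp : ∑ j, (I.p j : ℝ≥0∞) = 1 := by
    rw [← ENNReal.ofNNReal_finsetSum, I.p_sum, ENNReal.coe_one]
  have h := Finset.prod_univ_sum (fun _ : Fin I.T => Finset.univ)
    (fun (_ : Fin I.T) j => (I.p j : ℝ≥0∞))
  rw [Fintype.piFinset_univ, hp, Finset.prod_const_one] at h
  rw [arrivalAvg, ← Finset.sum_mul, ← h, one_mul]

theorem arrivalAvg_sum (I : MBOSM) {ι : Type*} (s : Finset ι)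
    (g : ι → (Fin I.T → Fin I.nJ) → ℝ≥0∞) :
    I.arrivalAvg (fun a => ∑ i ∈ s, g i a) = ∑ i ∈ s, I.arrivalAvg (g i) := by
  simp_rw [arrivalAvg, Finset.mul_sum]
  exact Finset.sum_comm

theorem arrivalAvg_mul_const (I : MBOSM) (g : (Fin I.T → Fin I.nJ) → ℝ≥0∞) (c : ℝ≥0∞) :
    I.arrivalAvg (fun a => g a * c) = I.arrivalAvg g * c := by
  simp_rw [arrivalAvg, Finset.sum_mul, mul_assoc]

end MBOSM

/-! ### The benchmark LP bounds every clairvoyant policy -/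

namespace MBOSM

variable (I : MBOSM)

theorem rate_nonneg (j : Fin I.nJ) : 0 ≤ I.rate j := by
  unfold rate
  positivity

theorem meanUtil_nonneg (e : I.Edge) : 0 ≤ I.meanUtil e := ENNReal.toReal_nonneg

theorem ofReal_meanUtil (e : I.Edge) :
    ENNReal.ofReal (I.meanUtil e) = ∫⁻ z, (z.2 : ℝ≥0∞) ∂I.law e :=
  ENNReal.ofReal_toReal (I.util_finite e)

variable {I}

theorem LPFeasible.le_rate {x : I.Edge → ℝ} (hx : I.LPFeasible x) (e : I.Edge) :
    x e ≤ I.rate e.1.2 :=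
  le_trans (Finset.single_le_sum (f := x) (s := Finset.univ.filter fun e' : I.Edge =>
    e'.1.2 = e.1.2) (fun e _ => hx.nonneg e) (Finset.mem_filter.2 ⟨Finset.mem_univ e, rfl⟩))
    (hx.arrival e.1.2)

variable (I) in
theorem isCompact_lpFeasible : IsCompact {x | I.LPFeasible x} := by
  refine IsCompact.of_isClosed_subset
    (isCompact_univ_pi fun e : I.Edge => isCompact_Icc (a := (0 : ℝ)) (b := I.rate e.1.2)) ?_
    fun x hx e _ => ⟨hx.nonneg e, hx.le_rate e⟩
  have : {x | I.LPFeasible x} = (⋂ e, {x | 0 ≤ x e}) ∩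
      (⋂ j, {x | ∑ e : I.Edge with e.1.2 = j, x e ≤ I.rate j}) ∩
      ⋂ k, {x | ∑ e, I.meanCost e k * x e ≤ I.budget k} := by
    ext x
    simp only [Set.mem_ofPred_eq, Set.mem_inter_iff, Set.mem_iInter]
    exact ⟨fun h => ⟨⟨h.nonneg, h.arrival⟩, h.budget⟩, fun h => ⟨h.1.1, h.1.2, h.2⟩⟩
  rw [this]
  refine ((isClosed_iInter fun e => ?_).inter (isClosed_iInter fun j => ?_)).inter
    (isClosed_iInter fun k => ?_)
  · exact isClosed_le continuous_const (continuous_apply e)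
  · exact isClosed_le (continuous_finsetSum _ fun e _ => continuous_apply e) continuous_const
  · exact isClosed_le (continuous_finsetSum _ fun e _ =>
      continuous_const.mul (continuous_apply e)) continuous_const

variable (I) in
-- The objective is continuous on a compact polytope that contains 0.
theorem exists_lpOptimal : ∃ x, I.LPOptimal x := by
  have h0 : I.LPFeasible fun _ => 0 :=
    ⟨fun _ => le_rfl, fun j => by simpa using I.rate_nonneg j, fun k => by simp⟩
  obtain ⟨x, hx, hmax⟩ := I.isCompact_lpFeasible.exists_isMaxOn ⟨_, h0⟩
    (f := I.lpObjective) (continuous_finsetSum _ fun e _ =>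
      continuous_const.mul (continuous_apply e)).continuousOn
  exact ⟨x, hx, fun y hy => hmax hy⟩

theorem LPOptimal.lpValue_eq {x : I.Edge → ℝ} (hx : I.LPOptimal x) :
    I.lpValue = ENNReal.ofReal (I.lpObjective x) :=
  le_antisymm (iSup₂_le fun y hy => ENNReal.ofReal_le_ofReal (hx.2 y hy))
    (le_iSup₂ (f := fun x (_ : I.LPFeasible x) => ENNReal.ofReal (I.lpObjective x)) x hx.1)

variable (I) in
theorem lpValue_ne_top : I.lpValue ≠ ∞ := by
  obtain ⟨x, hx⟩ := I.exists_lpOptimal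
  rw [hx.lpValue_eq]
  exact ENNReal.ofReal_ne_top

variable (I) in
theorem arrivalAvg_card (j : Fin I.nJ) :
    I.arrivalAvg (fun a => ((Finset.univ.filter fun s => a s = j).card : ℝ≥0∞)) =
      ENNReal.ofReal (I.rate j) := by
  simp_rw [Finset.card_filter, Nat.cast_sum]
  rw [arrivalAvg_sum]
  have : ∀ s : Fin I.T, I.arrivalAvg (fun a => ((if a s = j then 1 else 0 : ℕ) : ℝ≥0∞)) = I.p j := by
    intro s
    rw [arrivalAvg_update _ _ s]
    simp [arrivalAvg_const]
  simp_rw [this]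
  rw [Finset.sum_const, Finset.card_univ, Fintype.card_fin, rate, nsmul_eq_mul,
    ENNReal.ofReal_mul (by positivity), ENNReal.ofReal_natCast, ENNReal.ofReal_coe_nnreal]

namespace Policy

variable (π : I.Policy) (a : Fin I.T → Fin I.nJ)

theorem prob_le_one (t : ℕ) (ht : t < I.T) (h : Fin t → I.Outcome) (d : I.Decision) :
    π.prob a t ht h d ≤ 1 := by
  rw [← π.sum_one a t ht h]
  exact Finset.single_le_sum (fun d _ => π.nonneg a t ht h d) (Finset.mem_univ d)

theorem adds_le (e : I.Edge) : π.adds a e ≤ I.T := by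
  calc π.adds a e ≤ ∑ t : Fin I.T, 1 := by
        refine Finset.sum_le_sum fun t _ => ?_
        have := π.historyLaw_isProbability a t t.2.le
        calc _ ≤ ∫⁻ _, 1 ∂π.historyLaw a t t.2.le :=
              lintegral_mono fun h => ENNReal.ofReal_le_one.2 (π.prob_le_one a t t.2 h _)
          _ = 1 := by simp
    _ = I.T := by simp

theorem avg_adds_ne_top (e : I.Edge) : I.arrivalAvg (fun a => π.adds a e) ≠ ∞ :=
  ((I.arrivalAvg_mono fun a => π.adds_le a e).trans_eq (I.arrivalAvg_const _)).trans_lt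
    (ENNReal.natCast_lt_top _) |>.ne

theorem sum_lintegral_kernel_eq {S : Set I.Outcome} (hS : MeasurableSet S)
    (h0 : ((none : Option I.Edge), (fun _ => false, 0)) ∉ S) :
    ∑ t : Fin I.T, ∫⁻ h, π.kernel a t t.2 h S ∂π.historyLaw a t t.2.le =
      ∑ e : I.Edge, π.adds a e * I.law e {z | ((some e : Option I.Edge), z) ∈ S} := by
  have h := π.sum_lintegral_lintegral_kernel a (g := S.indicator 1) (measurable_one.indicator hS)
    (Set.indicator_of_notMem h0 _)
  simp_rw [lintegral_indicator_one hS] at h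
  rw [h]
  refine Finset.sum_congr rfl fun e _ => ?_
  congr 1
  exact lintegral_indicator_one (measurable_prodMk_left hS)

/-- A safe policy consumes at most the budget in expectation. -/
theorem sum_adds_mul_law_le (k : Fin I.K) :
    ∑ e : I.Edge, π.adds a e * I.law e {z | z.1 k = true} ≤ I.budget k := by
  classical
  let S : Set I.Outcome := {o | o.2.1 k = true}
  have hS : MeasurableSet S := (measurableSet_consume k).preimage measurable_snd
  have hnone : ((none : Option I.Edge), (fun _ => false, 0)) ∉ S := fun h => Bool.false_ne_true h
  refine (π.sum_lintegral_kernel_eq a hS hnone).symm.trans_le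
    (π.sum_lintegral_kernel_le a hS _ fun n hn h hc => ?_)
  rw [← lintegral_indicator_one hS, lintegral_kernel_of_none π a hn h
    (measurable_one.indicator hS) (Set.indicator_of_notMem hnone _)]
  refine Finset.sum_eq_zero fun e _ => ?_
  by_cases hp : π.prob a n hn h (some e) = 0
  · rw [hp, ENNReal.ofReal_zero, zero_mul]
  -- Once the budget is used up, a safe policy only adds edges without k in their support, and these
  -- consume k with probability zero.
  · have hk : k ∉ I.support e := by
      intro hk
      have := π.safe a n hn h e hp k hk
      rw [consumed_eq_sum] at this
      have hc' : I.budget k ≤ ∑ s, if (h s).2.1 k = true then 1 else 0 := by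
        convert hc
        rfl
      omega
    have h0 : I.law e {z | z.1 k = true} = 0 := by
      rw [mem_support, not_lt] at hk
      rw [law_consume, ENNReal.ofReal_of_nonpos hk]
    refine mul_eq_zero_of_right _ ?_
    rw [← h0, ← lintegral_indicator_one (measurableSet_consume k)]
    rfl

/-- The capping argument of `sum_lintegral_kernel_le`, with additions at j as the event and the
number of arrivals of j as the cap. -/
theorem IsClairvoyant.sum_adds_le {π : I.Policy} (hπ : π.IsClairvoyant) (a : Fin I.T → Fin I.nJ)
    (j : Fin I.nJ) : ∑ e : I.Edge with e.1.2 = j, π.adds a e ≤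
      ((Finset.univ.filter fun s => a s = j).card : ℝ≥0∞) := by
  classical
  let D : Set I.Decision := {d | ∃ e : I.Edge, d = some e ∧ e.1.2 = j}
  let S : Set I.Outcome := {o | o.1 ∈ D}
  have hS : MeasurableSet S := (MeasurableSet.of_discrete (s := D)).preimage measurable_fst
  have hnone : ∀ z, ((none : Option I.Edge), z) ∉ S := by
    rintro z ⟨e, he, -⟩
    exact Option.some_ne_none e he.symm
  have hsome : ∀ (e : I.Edge) z, ((some e : Option I.Edge), z) ∈ S ↔ e.1.2 = j := by
    intro e z
    constructor
    · rintro ⟨e', he, hj⟩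
      rw [Option.some_injective _ he]
      exact hj
    · exact fun h => ⟨e, rfl, h⟩
  have hle := π.sum_lintegral_kernel_le a hS (Finset.univ.filter fun s => a s = j).card
    fun n hn h hc => ?_
  · refine le_trans (le_of_eq ?_) hle
    rw [π.sum_lintegral_kernel_eq a hS (hnone _), Finset.sum_filter]
    refine Finset.sum_congr rfl fun e _ => ?_
    simp only [hsome]
    split_ifs with h <;> simp [h]
  · rw [← lintegral_indicator_one hS, lintegral_kernel_of_none π a hn h
      (measurable_one.indicator hS) (Set.indicator_of_notMem (hnone _) _)]
    refine Finset.sum_eq_zero fun e _ => ?_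
    by_cases hp : π.prob a n hn h (some e) = 0
    · rw [hp, ENNReal.ofReal_zero, zero_mul]
    · refine mul_eq_zero_of_right _ ?_
      have hej : e.1.2 ≠ j := by
        rintro rfl
        have := hπ a n hn h e hp
        rw [matched, Finset.card_filter] at this
        refine absurd (lt_of_lt_of_le this hc) (not_lt.2 (le_of_eq ?_))
        refine Finset.sum_congr rfl fun s _ => ?_
        congr
      have : ∀ z, S.indicator (1 : I.Outcome → ℝ≥0∞) ((some e : Option I.Edge), z) = 0 :=
        fun z => Set.indicator_of_notMem (fun hz => hej ((hsome e z).1 hz)) _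
      exact (lintegral_congr this).trans (by simp)

/-- Both constraints hold for each arrival sequence with the realized number of arrivals, whose mean
is the rate; averaging over the sequences turns them into those of the LP. -/
theorem IsClairvoyant.lpFeasible {π : I.Policy} (hπ : π.IsClairvoyant) :
    I.LPFeasible fun e => (I.arrivalAvg fun a => π.adds a e).toReal where
  nonneg e := ENNReal.toReal_nonneg
  arrival j := by
    rw [← ENNReal.toReal_sum fun e _ => π.avg_adds_ne_top e, ← arrivalAvg_sum]
    refine ENNReal.toReal_le_of_le_ofReal (I.rate_nonneg j) ?_
    rw [← arrivalAvg_card]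
    exact I.arrivalAvg_mono fun a => hπ.sum_adds_le a j
  budget k := by
    have h : ∑ e, I.arrivalAvg (fun a => π.adds a e) * ENNReal.ofReal (I.meanCost e k) ≤
        ENNReal.ofReal (I.budget k) := by
      simp_rw [← arrivalAvg_mul_const, ← law_consume]
      rw [← arrivalAvg_sum, ENNReal.ofReal_natCast, ← I.arrivalAvg_const (I.budget k)]
      exact I.arrivalAvg_mono fun a => π.sum_adds_mul_law_le a k
    have h2 := ENNReal.toReal_le_of_le_ofReal (Nat.cast_nonneg _) h
    rw [ENNReal.toReal_sum fun e _ =>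
      ENNReal.mul_ne_top (π.avg_adds_ne_top e) ENNReal.ofReal_ne_top] at h2
    refine le_trans (le_of_eq (Finset.sum_congr rfl fun e _ => ?_)) h2
    rw [ENNReal.toReal_mul, ENNReal.toReal_ofReal (meanCost_nonneg e k), mul_comm]

theorem value_eq_ofReal_lpObjective : π.value =
    ENNReal.ofReal (I.lpObjective fun e => (I.arrivalAvg fun a => π.adds a e).toReal) := by
  rw [value_eq, lpObjective, ENNReal.ofReal_sum_of_nonneg fun e _ =>
    mul_nonneg (I.meanUtil_nonneg e) ENNReal.toReal_nonneg]
  refine Finset.sum_congr rfl fun e _ => ?_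
  rw [ENNReal.ofReal_mul (I.meanUtil_nonneg e), ofReal_meanUtil,
    ENNReal.ofReal_toReal (π.avg_adds_ne_top e), mul_comm]

end Policy

variable (I) in
/-- The benchmark LP is an upper bound for every clairvoyant policy. -/
theorem optValue_le_lpValue : I.optValue ≤ I.lpValue :=
  iSup₂_le fun π hπ => by
    rw [π.value_eq_ofReal_lpObjective]
    exact le_iSup₂ (f := fun x (_ : I.LPFeasible x) => ENNReal.ofReal (I.lpObjective x)) _
      hπ.lpFeasible

end MBOSM

/-! ### The sampling algorithm: binomial domination of the consumption -/

namespace MBOSM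

variable {I : MBOSM}

namespace Policy

theorem IsOnline.historyLaw_congr {π : I.Policy} (hπ : π.IsOnline) {a a' : Fin I.T → Fin I.nJ}
    (n : ℕ) (hn : n ≤ I.T) (h : ∀ s : Fin I.T, s.1 < n → a s = a' s) :
    π.historyLaw a n hn = π.historyLaw a' n hn := by
  induction n with
  | zero => rfl
  | succ n ih =>
    have hk : π.kernel a n hn = π.kernel a' n hn := by
      ext1 x
      change (∑ d, ENNReal.ofReal (π.prob a n hn x d) • (I.realizationLaw d).map _) =
        ∑ d, ENNReal.ofReal (π.prob a' n hn x d) • (I.realizationLaw d).map _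
      refine Finset.sum_congr rfl fun d _ => ?_
      rw [hπ.nonanticipating a a' n hn x d fun s hs => h s (Nat.lt_succ_of_le hs)]
    rw [historyLaw, historyLaw, hk, ih _ fun s hs => h s (Nat.lt_succ_of_lt hs)]

/-- The arrival of the current round is independent of the history of an online policy. -/
theorem IsOnline.arrivalAvg_lintegral {π : I.Policy} (hπ : π.IsOnline) {n : ℕ} (hn : n < I.T)
    {G : (Fin I.T → Fin I.nJ) → (Fin n → I.Outcome) → ℝ≥0∞} (hG : ∀ a, Measurable (G a)) :
    I.arrivalAvg (fun a => ∫⁻ h, G a h ∂π.historyLaw a n hn.le) =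
      I.arrivalAvg fun a => ∫⁻ h, ∑ j, (I.p j : ℝ≥0∞) * G (Function.update a ⟨n, hn⟩ j) h
        ∂π.historyLaw a n hn.le := by
  rw [arrivalAvg_update _ _ ⟨n, hn⟩]
  congr 1
  funext a
  rw [lintegral_finsetSum _ fun j _ => (hG _).const_mul _]
  refine Finset.sum_congr rfl fun j _ => ?_
  rw [lintegral_const_mul _ (hG _), hπ.historyLaw_congr n hn.le fun s hs => ?_]
  exact Function.update_of_ne (fun h => by simp [h] at hs) _ _

end Policy

/-- The arrival probability cancels the denominator of the sampling probability, as p_j x_e/(T p_j)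
= x_e/T. -/
theorem sum_p_mul_sampEdge {x : I.Edge → ℝ} (hx : I.LPFeasible x) {n : ℕ} (hn : n < I.T)
    (h : Fin n → I.Outcome) (e : I.Edge) :
    ∑ j, (I.p j : ℝ≥0∞) * ENNReal.ofReal (I.sampEdge 1 x j h e) =
      {h | I.Safe h e}.indicator (fun _ => ENNReal.ofReal (x e / I.T)) h := by
  classical
  have hT : (0 : ℝ) < I.T := by exact_mod_cast (Nat.zero_le n).trans_lt hn
  rw [Finset.sum_eq_single e.1.2 (fun j _ hj => by simp [sampEdge, hj.symm])
    (fun h => absurd (Finset.mem_univ _) h)]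
  by_cases hs : I.Safe h e
  · rw [Set.indicator_of_mem (by exact hs)]
    rw [sampEdge, if_pos ⟨rfl, hs⟩, ← ENNReal.ofReal_coe_nnreal, ← ENNReal.ofReal_mul
      (NNReal.coe_nonneg _), one_mul, rate]
    congr 1
    -- For an agent that never arrives the quotient is the default value 0, but feasibility then
    -- forces x_e = 0 as well.
    rcases eq_or_ne (I.p e.1.2) 0 with hp | hp
    · have h1 := hx.le_rate e
      have h2 := hx.nonneg e
      rw [rate, hp, NNReal.coe_zero, mul_zero] at h1
      rw [hp, le_antisymm h1 h2]
      simp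
    · have : (I.p e.1.2 : ℝ) ≠ 0 := by exact_mod_cast hp
      field_simp
  · rw [Set.indicator_of_notMem (by exact hs), sampEdge, if_neg fun h => hs h.2]
    simp

theorem consumed_le {n : ℕ} (h : Fin n → I.Outcome) (k : Fin I.K) : I.consumed h k ≤ n :=
  (Finset.card_le_univ _).trans_eq (Fintype.card_fin n)

theorem measurableSet_safe (n : ℕ) (e : I.Edge) :
    MeasurableSet {h : Fin n → I.Outcome | I.Safe h e} := by
  have : {h : Fin n → I.Outcome | I.Safe h e} =
      ⋂ k, ⋂ (_ : k ∈ I.support e), {h | I.consumed h k + 1 ≤ I.budget k} := by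
    ext h
    simp [Safe]
  rw [this]
  refine MeasurableSet.iInter fun k => MeasurableSet.iInter fun _ => ?_
  exact (MeasurableSet.of_discrete (s := {c : ℕ | c + 1 ≤ I.budget k})).preimage
    (measurable_consumed n k)

section

variable {x : I.Edge → ℝ} (hx : I.LPFeasible x)

/-- Dropping the safety check only increases consumption; the remaining sum of a_{e,k} x_e/T is
controlled by the LP budget constraint. The bound holds for every history, which is what domination
needs. -/
theorem sum_p_mul_kernel_consume_le {n : ℕ} (hn : n < I.T)
    (a : Fin I.T → Fin I.nJ) (h : Fin n → I.Outcome) (k : Fin I.K) :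
    ∑ j, (I.p j : ℝ≥0∞) * (I.samp 1 ⟨zero_le_one, le_rfl⟩ x hx).kernel
      (Function.update a ⟨n, hn⟩ j) n hn h {o | o.2.1 k = true} ≤
      ENNReal.ofReal (I.budget k / I.T) := by
  have hT : (0 : ℝ) < I.T := by exact_mod_cast (Nat.zero_le n).trans_lt hn
  have hS : MeasurableSet {o : I.Outcome | o.2.1 k = true} :=
    (measurableSet_consume k).preimage measurable_snd
  have hnone : ((none : Option I.Edge), (fun _ => false, 0)) ∉ {o : I.Outcome | o.2.1 k = true} :=
    fun h => Bool.false_ne_true h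
  have hk : ∀ j, (I.samp 1 ⟨zero_le_one, le_rfl⟩ x hx).kernel
      (Function.update a ⟨n, hn⟩ j) n hn h {o | o.2.1 k = true} =
        ∑ e : I.Edge, ENNReal.ofReal (I.sampEdge 1 x j h e) * ENNReal.ofReal (I.meanCost e k) := by
    intro j
    rw [← lintegral_indicator_one hS, Policy.lintegral_kernel_of_none _ _ hn h
      (measurable_one.indicator hS) (Set.indicator_of_notMem hnone _)]
    refine Finset.sum_congr rfl fun e _ => ?_
    rw [← law_consume, ← lintegral_indicator_one (measurableSet_consume k)]
    simp only [samp, Function.update_self]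
    rfl
  simp_rw [hk, Finset.mul_sum, ← mul_assoc]
  rw [Finset.sum_comm]
  simp_rw [← Finset.sum_mul, sum_p_mul_sampEdge hx hn]
  calc _ ≤ ∑ e, ENNReal.ofReal (x e / I.T) * ENNReal.ofReal (I.meanCost e k) := by
        gcongr
        exact Set.indicator_le_self _ _ _
    _ = ENNReal.ofReal ((∑ e, I.meanCost e k * x e) / I.T) := by
        rw [Finset.sum_div, ENNReal.ofReal_sum_of_nonneg fun e _ =>
          div_nonneg (mul_nonneg (meanCost_nonneg e k) (hx.nonneg e)) hT.le]
        refine Finset.sum_congr rfl fun e _ => ?_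
        rw [← ENNReal.ofReal_mul (div_nonneg (hx.nonneg e) hT.le)]
        congr 1
        ring
    _ ≤ _ := by
        gcongr
        exact hx.budget k

theorem measurable_binomTail_consumed (p : ℝ) (m n : ℕ) (k : Fin I.K) :
    Measurable fun h : Fin n → I.Outcome =>
      ENNReal.ofReal (binomTail p m (I.budget k - I.consumed h k)) :=
  (measurable_of_countable fun c : ℕ =>
    ENNReal.ofReal (binomTail p m (I.budget k - c))).comp (measurable_consumed n k)

/-- The consumption of the sampling algorithm is dominated by a binomial random variable. -/
theorem arrivalAvg_binomTail_le {k : Fin I.K} (hk : I.budget k ≤ I.T) (n : ℕ) (hn : n ≤ I.T)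
    (m : ℕ) :
    I.arrivalAvg (fun a => ∫⁻ h, ENNReal.ofReal
      (binomTail (I.budget k / I.T) m (I.budget k - I.consumed h k))
        ∂(I.samp 1 ⟨zero_le_one, le_rfl⟩ x hx).historyLaw a n hn) ≤
      ENNReal.ofReal (binomTail (I.budget k / I.T) (m + n) (I.budget k)) := by
  have hp0 : (0 : ℝ) ≤ I.budget k / I.T := by positivity
  have hp1 : (I.budget k / I.T : ℝ) ≤ 1 := div_le_one_of_le₀ (by exact_mod_cast hk) (by positivity)
  have hbk := fun (n : ℕ) (hn : n < I.T) a h => sum_p_mul_kernel_consume_le hx hn a h k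
  set p : ℝ := I.budget k / I.T with hp
  set π := I.samp 1 ⟨zero_le_one, le_rfl⟩ x hx with hπ
  induction n generalizing m with
  | zero =>
    refine (I.arrivalAvg_mono fun a => ?_).trans_eq (I.arrivalAvg_const _)
    change ∫⁻ h, _ ∂(Measure.dirac Fin.elim0) ≤ _
    rw [lintegral_dirac' _ (measurable_binomTail_consumed p m 0 k)]
    simp [consumed]
  | succ n ih =>
    -- The potential is the chance that m Bernoulli trials exhaust what is left of the budget. The
    -- last real round is replaced by one more trial, so n decreases while m increases.
    refine le_trans ?_ ((ih (Nat.le_of_succ_le hn) (m + 1)).trans_eq (by rw [add_right_comm]; rfl))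
    have hmeas := measurable_binomTail_consumed p m (n + 1) k
    simp_rw [π.lintegral_historyLaw_succ _ hn hmeas]
    have hon : π.IsOnline := I.samp_isOnline 1 _ x hx
    rw [hon.arrivalAvg_lintegral hn fun a => π.measurable_lintegral_kernel a hn
      (f := fun h o => ENNReal.ofReal (binomTail p m
        (I.budget k - I.consumed (Fin.snoc (α := fun _ => I.Outcome) h o) k)))
        (hmeas.comp (measurable_snoc n))]
    refine I.arrivalAvg_mono fun a => lintegral_mono fun h => ?_
    have hS : MeasurableSet {o : I.Outcome | o.2.1 k = true} :=
      (measurableSet_consume k).preimage measurable_snd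
    have hpsum : ∑ j, (I.p j : ℝ≥0∞) = 1 := by
      rw [← ENNReal.ofNNReal_finsetSum, I.p_sum, ENNReal.coe_one]
    rcases le_or_gt (I.budget k) (I.consumed h k) with hc | hc
    · have : ∀ o, I.budget k -
          I.consumed (Fin.snoc (α := fun _ => I.Outcome) h o) k = 0 := fun o => by
        rw [consumed_snoc]
        omega
      simp_rw [this]
      simp [hpsum, Nat.sub_eq_zero_of_le hc]
    · obtain ⟨b, hb⟩ : ∃ b, I.budget k - I.consumed h k = b + 1 :=
        Nat.exists_eq_succ_of_ne_zero (by omega)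
      have hd := sub_nonneg.2 (binomTail_succ_le hp0 hp1 m b)
      -- Consuming a unit raises the potential by a nonnegative amount, so an upper bound on the
      -- consumption probability is enough.
      have hsnoc : ∀ o, ENNReal.ofReal (binomTail p m (I.budget k -
          I.consumed (Fin.snoc (α := fun _ => I.Outcome) h o) k)) =
          ENNReal.ofReal (binomTail p m (b + 1)) +
            ENNReal.ofReal (binomTail p m b - binomTail p m (b + 1)) *
              {o : I.Outcome | o.2.1 k = true}.indicator 1 o := by
        intro o
        rw [consumed_snoc]
        by_cases ho : o.2.1 k = true
        · rw [if_pos ho, Set.indicator_of_mem (by exact ho), Pi.one_apply, mul_one,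
            ← ENNReal.ofReal_add (binomTail_nonneg hp0 hp1 _ _) hd, add_sub_cancel,
            show I.budget k - (I.consumed h k + 1) = b by omega]
        · rw [if_neg ho, Set.indicator_of_notMem (by exact ho), mul_zero, add_zero, add_zero, hb]
      simp_rw [hsnoc]
      have hint : ∀ a', ∫⁻ o, (ENNReal.ofReal (binomTail p m (b + 1)) +
            ENNReal.ofReal (binomTail p m b - binomTail p m (b + 1)) *
              {o : I.Outcome | o.2.1 k = true}.indicator 1 o) ∂π.kernel a' n hn h =
          ENNReal.ofReal (binomTail p m (b + 1)) +
            ENNReal.ofReal (binomTail p m b - binomTail p m (b + 1)) *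
              π.kernel a' n hn h {o : I.Outcome | o.2.1 k = true} := by
        intro a'
        rw [lintegral_add_left measurable_const, lintegral_const_mul _ (measurable_one.indicator hS),
          lintegral_indicator_one hS]
        simp
      simp_rw [hint, mul_add, mul_left_comm _ (ENNReal.ofReal (_ - _))]
      rw [Finset.sum_add_distrib, ← Finset.sum_mul, ← Finset.mul_sum, hpsum, one_mul]
      calc _ ≤ ENNReal.ofReal (binomTail p m (b + 1)) +
            ENNReal.ofReal (binomTail p m b - binomTail p m (b + 1)) * ENNReal.ofReal p := by
            gcongr
            exact hbk n hn a h
        _ = _ := by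
            rw [← ENNReal.ofReal_mul hd, ← ENNReal.ofReal_add (binomTail_nonneg hp0 hp1 _ _)
              (mul_nonneg hd hp0), hb, binomTail_succ_succ]
            congr 1
            ring

/-- With zero trials left the tail is the indicator that the budget is exhausted. A budget above T
cannot run out, and there b/T > 1 is not a probability, so it is treated separately. -/
theorem arrivalAvg_exhausted_le (k : Fin I.K) (n : ℕ) (hn : n < I.T) :
    I.arrivalAvg (fun a => ∫⁻ h, ENNReal.ofReal
      (binomTail (I.budget k / I.T) 0 (I.budget k - I.consumed h k))
        ∂(I.samp 1 ⟨zero_le_one, le_rfl⟩ x hx).historyLaw a n hn.le) ≤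
      ENNReal.ofReal (binomTail (I.budget k / I.T) n (I.budget k)) := by
  rcases le_or_gt (I.budget k) I.T with hk | hk
  · simpa using arrivalAvg_binomTail_le hx hk n hn.le 0
  · refine (I.arrivalAvg_mono fun a => ?_).trans_eq (I.arrivalAvg_const 0) |>.trans (zero_le)
    refine (lintegral_eq_zero_of_ae_eq_zero (ae_of_all _ fun h => ?_)).le
    have := consumed_le h k
    rw [binomTail_eq_zero _ (by omega)]
    simp

/-- A union bound: an unsafe edge has an exhausted resource in its support. -/
theorem ofReal_le_arrivalAvg_safe (e : I.Edge) (n : ℕ) (hn : n < I.T) :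
    ENNReal.ofReal (1 - ∑ k ∈ I.support e, binomTail (I.budget k / I.T) n (I.budget k)) ≤
      I.arrivalAvg fun a => (I.samp 1 ⟨zero_le_one, le_rfl⟩ x hx).historyLaw a n hn.le
        {h | I.Safe h e} := by
  set π := I.samp 1 ⟨zero_le_one, le_rfl⟩ x hx with hπ
  have hle : ∀ k : Fin I.K, I.budget k ≤ I.T → (I.budget k / I.T : ℝ) ≤ 1 := fun k hk =>
    div_le_one_of_le₀ (by exact_mod_cast hk) (by positivity)
  have h0 : ∀ k : Fin I.K, 0 ≤ binomTail (I.budget k / I.T) n (I.budget k) := by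
    intro k
    rcases le_or_gt (I.budget k) I.T with hk | hk
    · exact binomTail_nonneg (by positivity) (hle k hk) _ _
    · rw [binomTail_eq_zero _ (by omega)]
  rw [ENNReal.ofReal_sub _ (Finset.sum_nonneg fun k _ => h0 k), ENNReal.ofReal_one,
    tsub_le_iff_right, ENNReal.ofReal_sum_of_nonneg fun k _ => h0 k]
  calc (1 : ℝ≥0∞) = I.arrivalAvg fun _ => 1 := (I.arrivalAvg_const 1).symm
    _ ≤ I.arrivalAvg fun a => π.historyLaw a n hn.le {h | I.Safe h e} +
          ∑ k ∈ I.support e, ∫⁻ h, ENNReal.ofReal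
            (binomTail (I.budget k / I.T) 0 (I.budget k - I.consumed h k))
              ∂π.historyLaw a n hn.le := by
        refine I.arrivalAvg_mono fun a => ?_
        have := π.historyLaw_isProbability a n hn.le
        rw [← lintegral_indicator_one (measurableSet_safe n e), ← lintegral_finsetSum _
          fun k _ => measurable_binomTail_consumed _ 0 n k, ← lintegral_add_left
          (measurable_one.indicator (measurableSet_safe n e))]
        calc (1 : ℝ≥0∞) = ∫⁻ _, 1 ∂π.historyLaw a n hn.le := by simp
          _ ≤ _ := lintegral_mono fun h => ?_
        by_cases hs : I.Safe h e
        · rw [Set.indicator_of_mem (by exact hs)]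
          exact le_self_add
        · have hs' := hs
          simp only [Safe, not_forall] at hs'
          obtain ⟨k, hk, hc⟩ := hs'
          refine le_trans ?_ (le_add_left (Finset.single_le_sum (f := fun k => ENNReal.ofReal
            (binomTail (I.budget k / I.T) 0 (I.budget k - I.consumed h k)))
            (fun _ _ => zero_le) hk))
          dsimp only
          rw [Nat.sub_eq_zero_of_le (by omega), binomTail_zero_right, ENNReal.ofReal_one]
    _ ≤ _ := by
        have hadd : ∀ f g : (Fin I.T → Fin I.nJ) → ℝ≥0∞,
            I.arrivalAvg (fun a => f a + g a) = I.arrivalAvg f + I.arrivalAvg g := fun f g => by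
          simp [arrivalAvg, mul_add, Finset.sum_add_distrib]
        rw [hadd, arrivalAvg_sum]
        gcongr with k hk
        exact arrivalAvg_exhausted_le hx k n hn

/-- The current arrival is independent of the history, so each round contributes x_e/T times the
probability that e is safe. -/
theorem arrivalAvg_adds_samp (e : I.Edge) :
    I.arrivalAvg (fun a => (I.samp 1 ⟨zero_le_one, le_rfl⟩ x hx).adds a e) =
      ENNReal.ofReal (x e / I.T) * ∑ t : Fin I.T, I.arrivalAvg fun a =>
        (I.samp 1 ⟨zero_le_one, le_rfl⟩ x hx).historyLaw a t t.2.le {h | I.Safe h e} := by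
  set π := I.samp 1 ⟨zero_le_one, le_rfl⟩ x hx with hπ
  simp only [Policy.adds]
  rw [arrivalAvg_sum, Finset.mul_sum]
  refine Finset.sum_congr rfl fun t _ => ?_
  refine ((I.samp_isOnline 1 _ x hx).arrivalAvg_lintegral t.2
    fun a => π.measurable_ofReal_prob a t.2 _).trans ?_
  rw [mul_comm, ← arrivalAvg_mul_const]
  congr 1
  funext a
  have : ∀ h, ∑ j, (I.p j : ℝ≥0∞) *
      ENNReal.ofReal (π.prob (Function.update a t j) t t.2 h (some e)) =
        {h | I.Safe h e}.indicator (fun _ => ENNReal.ofReal (x e / I.T)) h := by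
    intro h
    rw [← sum_p_mul_sampEdge hx t.2]
    simp [hπ, samp]
  refine (lintegral_congr this).trans ?_
  rw [lintegral_indicator_const (measurableSet_safe _ e), mul_comm]

/-- By linearity it suffices to compare edge by edge: the expected number of additions of e must be
at least ρ x_e. -/
theorem mem_sampRatios {Δ B T : ℕ} (hT : 0 < T) {ρ : ℝ} (hρ : ρ ∈ Set.Icc (0 : ℝ) 1)
    (h : ∀ I : MBOSM, InClass Δ B T I → ∀ e, ρ * T ≤ ∑ t ∈ Finset.range T,
      max 0 (1 - ∑ k ∈ I.support e, binomTail (I.budget k / T) t (I.budget k))) :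
    ρ ∈ sampRatios Δ B T := by
  refine ⟨hρ, fun I hI x hx => ?_⟩
  have hTr : (0 : ℝ) < T := by positivity
  obtain rfl := hI.horizon
  rw [hx.lpValue_eq, Policy.value_eq, lpObjective, ENNReal.ofReal_sum_of_nonneg fun e _ =>
    mul_nonneg (I.meanUtil_nonneg e) (hx.1.nonneg e), Finset.mul_sum]
  refine Finset.sum_le_sum fun e _ => ?_
  rw [ENNReal.ofReal_mul (I.meanUtil_nonneg e), ofReal_meanUtil, mul_left_comm, mul_comm]
  gcongr
  rw [arrivalAvg_adds_samp]
  calc ENNReal.ofReal ρ * ENNReal.ofReal (x e) =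
        ENNReal.ofReal (x e / I.T) * ENNReal.ofReal (ρ * I.T) := by
        rw [← ENNReal.ofReal_mul hρ.1, ← ENNReal.ofReal_mul (div_nonneg (hx.1.nonneg e) hTr.le)]
        congr 1
        field_simp
    _ ≤ _ := by
        gcongr
        refine (ENNReal.ofReal_le_ofReal (h I hI e)).trans ?_
        rw [ENNReal.ofReal_sum_of_nonneg fun _ _ => le_max_left _ _, Finset.sum_range]
        refine Finset.sum_le_sum fun t _ => ?_
        rw [ENNReal.ofReal_max, ENNReal.ofReal_zero, max_eq_right (zero_le)]
        exact ofReal_le_arrivalAvg_safe hx.1 e t t.2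

end

theorem InClass.le_budget {Δ B T : ℕ} (hI : InClass Δ B T I) (k : Fin I.K) : B ≤ I.budget k :=
  hI.minBudget.2 ⟨k, rfl⟩

/-- The support has at most one resource, so exchanging the sums leaves a single average of tails,
bounded uniformly in budgets at least B. -/
theorem mem_sampRatios_one {B T : ℕ} (hB : 0 < B) (hT : 0 < T)
    (h0 : 0 ≤ 1 - 1 / √(2 * Real.pi * B) * (Stirling.stirlingSeq T / √Real.pi)) :
    1 - 1 / √(2 * Real.pi * B) * (Stirling.stirlingSeq T / √Real.pi) ∈ sampRatios 1 B T := by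
  have hTr : (0 : ℝ) < T := by positivity
  have hs : 0 ≤ 1 / √(2 * Real.pi * B) * (Stirling.stirlingSeq T / √Real.pi) := by
    have := (Real.sqrt_nonneg _).trans (Stirling.sqrt_pi_le_stirlingSeq hT.ne')
    positivity
  refine mem_sampRatios hT ⟨h0, by linarith⟩ fun I hI e => ?_
  refine le_trans ?_ (Finset.sum_le_sum fun t _ => le_max_right _ _)
  rw [Finset.sum_sub_distrib, Finset.sum_comm]
  have hk : ∀ k : Fin I.K, ∑ t ∈ Finset.range T, binomTail (I.budget k / T) t (I.budget k) ≤
      (1 / √(2 * Real.pi * B) * (Stirling.stirlingSeq T / √Real.pi)) * T := by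
    intro k
    rcases le_or_gt (I.budget k) T with hkT | hkT
    · have := binomLoss_le hB (hI.le_budget k) hkT
      rwa [binomLoss, div_le_iff₀ hTr] at this
    · rw [Finset.sum_eq_zero fun t ht => binomTail_eq_zero _
        ((Finset.mem_range.1 ht).trans hkT)]
      positivity
  have hsum : ∑ k ∈ I.support e, ∑ t ∈ Finset.range T,
      binomTail (I.budget k / T) t (I.budget k) ≤
        (1 / √(2 * Real.pi * B) * (Stirling.stirlingSeq T / √Real.pi)) * T := by
    refine (Finset.sum_le_card_nsmul _ _ _ fun k _ => hk k).trans ?_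
    rw [nsmul_eq_mul]
    refine mul_le_of_le_one_left (by positivity) ?_
    exact_mod_cast hI.sparsity e
  simp only [Finset.sum_const, Finset.card_range, nsmul_eq_mul, mul_one]
  linarith

/-- The Chernoff bound decreases in the budget, so each of at most Δ tails is bounded by the one
with budget B; the cap at 1 comes from nonnegativity of the safety probability. -/
theorem mem_sampRatios_general {Δ B T : ℕ} (hΔ : 1 < Δ) (hB : 0 < B) (hT : 0 < T) {ρ : ℝ}
    (hρ : ρ = 1 - (√(2 * Real.log Δ / B) + 2 / T + 1 / (B * √(2 * Real.log Δ / B))))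
    (h0 : 0 ≤ ρ) : ρ ∈ sampRatios Δ B T := by
  have hTr : (0 : ℝ) < T := by positivity
  have hBr : (0 : ℝ) < B := by positivity
  have hs : 0 ≤ √(2 * Real.log Δ / B) + 2 / T + 1 / (B * √(2 * Real.log Δ / B)) := by positivity
  refine mem_sampRatios hT ⟨h0, by linarith⟩ fun I hI e => ?_
  have hsum := sum_min_exp_le (Δ := Δ) (B := B) (by exact_mod_cast hΔ) hBr hT
  rw [div_le_iff₀ hTr] at hsum
  calc ρ * T ≤ ∑ t ∈ Finset.range T,
        (1 - min 1 (Δ * Real.exp (-(B * (1 - t / T) ^ 2 / 2)))) := by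
        rw [Finset.sum_sub_distrib]
        simp only [Finset.sum_const, Finset.card_range, nsmul_eq_mul, mul_one]
        rw [hρ]
        linarith
    _ ≤ _ := by
        refine Finset.sum_le_sum fun t ht => ?_
        have htT := Finset.mem_range.1 ht
        have htail : ∑ k ∈ I.support e, binomTail (I.budget k / T) t (I.budget k) ≤
            Δ * Real.exp (-(B * (1 - t / T) ^ 2 / 2)) := by
          have hk : ∀ k ∈ I.support e, binomTail (I.budget k / T) t (I.budget k) ≤
              Real.exp (-(B * (1 - t / T) ^ 2 / 2)) := by
            intro k _
            rcases le_or_gt (I.budget k) T with hkT | hkT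
            · refine (binomTail_le_exp hkT htT).trans ?_
              gcongr
              exact hI.le_budget k
            · rw [binomTail_eq_zero _ (htT.trans hkT)]
              positivity
          refine (Finset.sum_le_card_nsmul _ _ _ hk).trans ?_
          rw [nsmul_eq_mul]
          gcongr
          exact hI.sparsity e
        rcases le_total 1 (Δ * Real.exp (-(B * (1 - (t : ℝ) / T) ^ 2 / 2))) with h | h
        · rw [min_eq_left h, sub_self]
          exact le_max_left _ _
        · rw [min_eq_right h]
          exact le_max_of_le_right (by linarith)

end MBOSM

/-! ### The hard instance: one edge with independent costs -/

theorem lintegral_pi_prod_of_fintype {ι α : Type*} [Fintype ι] [Fintype α] [MeasurableSpace α]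
    [MeasurableSingletonClass α] (μ : Measure α) [IsProbabilityMeasure μ] (f : ι → α → ℝ≥0∞) :
    ∫⁻ x, ∏ i, f i (x i) ∂Measure.pi (fun _ : ι => μ) = ∏ i, ∫⁻ b, f i b ∂μ := by
  classical
  simp_rw [lintegral_fintype, Measure.pi_singleton, ← Finset.prod_mul_distrib]
  rw [Finset.prod_univ_sum, Fintype.piFinset_univ]

/-- The Bernoulli distribution on `Bool`. -/
noncomputable def boolBernoulli (p : ℝ≥0) : Measure Bool :=
  (p : ℝ≥0∞) • Measure.dirac true + ((1 - p : ℝ≥0) : ℝ≥0∞) • Measure.dirac false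

theorem isProbabilityMeasure_boolBernoulli {p : ℝ≥0} (hp : p ≤ 1) :
    IsProbabilityMeasure (boolBernoulli p) := by
  refine ⟨?_⟩
  simp only [boolBernoulli, Measure.add_apply, Measure.smul_apply, measure_univ, smul_eq_mul,
    mul_one]
  rw [← ENNReal.coe_add, add_tsub_cancel_of_le hp, ENNReal.coe_one]

theorem lintegral_boolBernoulli (p : ℝ≥0) (f : Bool → ℝ≥0∞) :
    ∫⁻ b, f b ∂boolBernoulli p = p * f true + (1 - p : ℝ≥0) * f false := by
  rw [boolBernoulli, lintegral_add_measure, lintegral_smul_measure, lintegral_smul_measure,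
    lintegral_dirac, lintegral_dirac, smul_eq_mul, smul_eq_mul]

namespace MBOSM

/-- The law of the cost and utility of the only edge of `iidInstance`. -/
noncomputable def iidLaw (K : ℕ) (p : ℝ≥0) : Measure ((Fin K → Bool) × ℝ≥0) :=
  (Measure.pi fun _ : Fin K => boolBernoulli p).map fun c => (c, 1)

theorem lintegral_iidLaw (K : ℕ) (p : ℝ≥0) {g : (Fin K → Bool) × ℝ≥0 → ℝ≥0∞} (hg : Measurable g) :
    ∫⁻ z, g z ∂iidLaw K p = ∫⁻ c, g (c, 1) ∂Measure.pi fun _ : Fin K => boolBernoulli p := by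
  rw [iidLaw, lintegral_map hg measurable_prodMk_right]

theorem isProbabilityMeasure_iidLaw (K : ℕ) {p : ℝ≥0} (hp : p ≤ 1) :
    IsProbabilityMeasure (iidLaw K p) := by
  have := isProbabilityMeasure_boolBernoulli hp
  exact Measure.isProbabilityMeasure_map measurable_prodMk_right.aemeasurable

/-- The instance with one edge of unit utility that consumes each of `K` resources independently
with probability `p`. -/
noncomputable def iidInstance (K B T : ℕ) (hB : 0 < B) (p : ℝ≥0) (hp : p ≤ 1) : MBOSM where
  nI := 1
  nJ := 1
  K := K
  T := T
  E := Finset.univ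
  budget _ := B
  budget_pos _ := hB
  p _ := 1
  p_sum := by simp
  law _ := iidLaw K p
  law_prob _ := isProbabilityMeasure_iidLaw K hp
  util_finite _ := by
    have := isProbabilityMeasure_boolBernoulli hp
    rw [lintegral_iidLaw K p measurable_snd.coe_nnreal_ennreal]
    simp

section

variable {K B T : ℕ} (hB : 0 < B) {p : ℝ≥0} (hp : p ≤ 1)

theorem inClass_iidInstance (hK : 0 < K) : InClass K B T (iidInstance K B T hB p hp) where
  horizon := rfl
  sparsity e := (Finset.card_le_univ _).trans_eq (Fintype.card_fin K)
  minBudget := by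
    refine ⟨⟨(⟨0, hK⟩ : Fin K), rfl⟩, ?_⟩
    rintro _ ⟨k, rfl⟩
    exact le_rfl

theorem meanCost_iidInstance (e : (iidInstance K B T hB p hp).Edge) (k : Fin K) :
    (iidInstance K B T hB p hp).meanCost e k = p := by
  have := isProbabilityMeasure_boolBernoulli hp
  have h : iidLaw K p {z | z.1 k = true} = p := by
    have hS : MeasurableSet {z : (Fin K → Bool) × ℝ≥0 | z.1 k = true} :=
      measurableSet_eq_fun ((measurable_pi_apply k).comp measurable_fst) measurable_const
    rw [iidLaw, Measure.map_apply measurable_prodMk_right hS]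
    have := (measurePreserving_eval (fun _ : Fin K => boolBernoulli p) k).measure_preimage
      (MeasurableSet.of_discrete (s := {true})).nullMeasurableSet
    refine Eq.trans (by rfl) (this.trans ?_)
    simp [boolBernoulli]
  exact (congrArg ENNReal.toReal h).trans (ENNReal.coe_toReal p)

theorem meanUtil_iidInstance (e : (iidInstance K B T hB p hp).Edge) :
    (iidInstance K B T hB p hp).meanUtil e = 1 := by
  have := isProbabilityMeasure_boolBernoulli hp
  change (∫⁻ z, (z.2 : ℝ≥0∞) ∂iidLaw K p).toReal = 1
  rw [lintegral_iidLaw K p measurable_snd.coe_nnreal_ennreal]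
  simp

theorem card_edge_iidInstance : Fintype.card (iidInstance K B T hB p hp).Edge = 1 := by
  change Fintype.card {e : Fin 1 × Fin 1 // e ∈ (Finset.univ : Finset (Fin 1 × Fin 1))} = 1
  simp

/-- Adding the only edge in all T rounds is fractionally feasible. -/
theorem le_lpValue_iidInstance (hpT : (p : ℝ) * T ≤ B) :
    (T : ℝ≥0∞) ≤ (iidInstance K B T hB p hp).lpValue := by
  let I := iidInstance K B T hB p hp
  have hcost : ∀ e k, I.meanCost e k = p := meanCost_iidInstance hB hp
  have hutil : ∀ e, I.meanUtil e = 1 := meanUtil_iidInstance hB hp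
  have hcard : Fintype.card I.Edge = 1 := card_edge_iidInstance hB hp
  have hx : I.LPFeasible fun _ => (T : ℝ) := by
    refine ⟨fun _ => Nat.cast_nonneg _, fun j => ?_, fun k => ?_⟩
    · rw [Finset.sum_const, nsmul_eq_mul]
      have h1 : (Finset.univ.filter fun e : I.Edge => e.1.2 = j).card ≤ 1 :=
        (Finset.card_le_univ _).trans_eq hcard
      have h2 : I.rate j = T := by
        change (T : ℝ) * ((1 : ℝ≥0) : ℝ) = T
        simp
      rw [h2]
      exact mul_le_of_le_one_left (Nat.cast_nonneg _) (by exact_mod_cast h1)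
    · simp_rw [hcost]
      rw [Finset.sum_const, Finset.card_univ, hcard, one_smul]
      exact hpT
  refine le_trans (le_of_eq ?_)
    (le_iSup₂ (f := fun x (_ : I.LPFeasible x) => ENNReal.ofReal (I.lpObjective x)) _ hx)
  rw [lpObjective]
  simp_rw [hutil]
  rw [Finset.sum_const, Finset.card_univ, hcard, one_smul, one_mul,
    ENNReal.ofReal_natCast]

/-- The probability that a resource of which `c` units have been consumed is available after `m`
further additions. -/
noncomputable def availProb (p : ℝ≥0) (B m c : ℕ) : ℝ≥0∞ :=
  ENNReal.ofReal (1 - binomTail p m (B - c))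

include hp in
-- Condition on the first of m + 1 trials. Truncated subtraction gives an exhausted resource
-- availability 0 forever.
theorem lintegral_availProb (m c : ℕ) :
    ∫⁻ b : Bool, availProb p B m (c + if b = true then 1 else 0) ∂boolBernoulli p =
      availProb p B (m + 1) c := by
  have hp1 : (p : ℝ) ≤ 1 := by exact_mod_cast hp
  have hb := fun j => binomTail_le_one (NNReal.coe_nonneg p) hp1 m j
  rw [lintegral_boolBernoulli]
  simp only [availProb, if_true, Bool.false_eq_true, if_false, add_zero]
  rcases le_or_gt B c with h | h
  · simp [Nat.sub_eq_zero_of_le h, Nat.sub_eq_zero_of_le (h.trans (Nat.le_succ c))]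
  · obtain ⟨b, hb'⟩ : ∃ b, B - c = b + 1 := Nat.exists_eq_succ_of_ne_zero (by omega)
    rw [show B - (c + 1) = b by omega, hb', binomTail_succ_succ, ← ENNReal.ofReal_coe_nnreal,
      ← ENNReal.ofReal_coe_nnreal, NNReal.coe_sub hp, NNReal.coe_one,
      ← ENNReal.ofReal_mul (by positivity), ← ENNReal.ofReal_mul (by linarith),
      ← ENNReal.ofReal_add (mul_nonneg (by positivity) (by linarith [hb b]))
        (mul_nonneg (by linarith) (by linarith [hb (b + 1)]))]
    congr 1
    ring

/-- Expected number of additions in `n` rounds if the edge of `iidInstance` is added whenever this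
is safe. -/
noncomputable def greedyAdds (p : ℝ≥0) (B n : ℕ) (C : Fin K → ℕ) : ℝ≥0∞ :=
  ∑ m ∈ Finset.range n, ∏ k, availProb p B m (C k)

theorem greedyAdds_le_succ (n : ℕ) (C : Fin K → ℕ) :
    greedyAdds p B n C ≤ greedyAdds p B (n + 1) C := by
  rw [greedyAdds, greedyAdds, Finset.sum_range_succ]
  exact le_self_add

include hp in
-- Independence of the resources factorizes the expectation, and one addition advances every factor
-- by one trial.
theorem lintegral_greedyAdds (n : ℕ) (C : Fin K → ℕ) :
    ∫⁻ c : Fin K → Bool, greedyAdds p B n (fun k => C k + if c k = true then 1 else 0)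
      ∂(Measure.pi fun _ : Fin K => boolBernoulli p) =
      ∑ m ∈ Finset.range n, ∏ k, availProb p B (m + 1) (C k) := by
  have := isProbabilityMeasure_boolBernoulli hp
  simp only [greedyAdds]
  rw [lintegral_finsetSum _ fun m _ => measurable_of_countable _]
  refine Finset.sum_congr rfl fun m _ => ?_
  rw [lintegral_pi_prod_of_fintype (boolBernoulli p)
    (fun k b => availProb p B m (C k + if b = true then 1 else 0))]
  simp_rw [lintegral_availProb hp]

/-- The Bellman equation of the greedy policy: when the edge is safe, the term m = 0 is the sure
addition made now. -/
theorem one_add_sum_availProb {C : Fin K → ℕ} (hC : ∀ k, C k + 1 ≤ B) (n : ℕ) :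
    1 + ∑ m ∈ Finset.range n, ∏ k, availProb p B (m + 1) (C k) = greedyAdds p B (n + 1) C := by
  rw [greedyAdds, Finset.sum_range_succ', add_comm]
  congr 1
  rw [Finset.prod_eq_one]
  intro k _
  have := hC k
  rw [availProb, binomTail_eq_zero _ (by omega), sub_zero, ENNReal.ofReal_one]

/-- No policy gains more than the greedy policy if every edge yields unit utility and consumes each
resource independently with probability `p`. -/
theorem value_le_greedyAdds {I : MBOSM} (hp0 : 0 < p) (hbudget : ∀ k, I.budget k = B)
    (hcost : ∀ e k, I.meanCost e k = p)
    (hlaw : ∀ (e : I.Edge) (g : (Fin I.K → Bool) × ℝ≥0 → ℝ≥0∞), Measurable g →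
      ∫⁻ z, g z ∂I.law e = ∫⁻ c, g (c, 1) ∂Measure.pi fun _ : Fin I.K => boolBernoulli p)
    (hp : p ≤ 1) (π : I.Policy) :
    π.value ≤ greedyAdds p B I.T (fun _ : Fin I.K => 0) := by
  have hpi := isProbabilityMeasure_boolBernoulli hp
  -- Utility earned so far plus the greedy value of the remaining rounds is a supermartingale under
  -- every policy: a safe addition preserves it on average, and a rejection forfeits a round.
  let f : (n : ℕ) → (Fin n → I.Outcome) → ℝ≥0∞ := fun n h =>
    ∑ s, ((h s).2.2 : ℝ≥0∞) + greedyAdds p B (I.T - n) (fun k => I.consumed h k)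
  have hsum : ∀ n, Measurable fun h : Fin n → I.Outcome => ∑ s, ((h s).2.2 : ℝ≥0∞) := fun n =>
    Finset.measurable_sum _ fun s _ =>
      (measurable_snd.comp (measurable_snd.comp (measurable_pi_apply s))).coe_nnreal_ennreal
  have hf : ∀ n, Measurable (f n) := fun n => by
    refine (hsum n).add ?_
    have h1 : Measurable fun h : Fin n → I.Outcome => fun k => I.consumed h k :=
      measurable_pi_lambda _ fun k => measurable_consumed n k
    exact (measurable_of_countable (greedyAdds p B (I.T - n))).comp h1
  have hstep : ∀ a n (hn : n < I.T) (h : Fin n → I.Outcome),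
      ∫⁻ o, f (n + 1) (Fin.snoc (α := fun _ => I.Outcome) h o) ∂π.kernel a n hn h ≤ f n h := by
    intro a n hn h
    have hTn : I.T - n = I.T - (n + 1) + 1 := by omega
    have hs1 : Measurable fun o : I.Outcome => Fin.snoc (α := fun _ => I.Outcome) h o :=
      (measurable_snoc n).comp measurable_prodMk_left
    rw [π.lintegral_kernel a hn h
      (g := fun o => f (n + 1) (Fin.snoc (α := fun _ => I.Outcome) h o)) ((hf (n + 1)).comp hs1)]
    have hd : ∀ d : I.Decision, ENNReal.ofReal (π.prob a n hn h d) *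
        ∫⁻ z, f (n + 1) (Fin.snoc (α := fun _ => I.Outcome) h (d, z)) ∂I.realizationLaw d ≤
          ENNReal.ofReal (π.prob a n hn h d) * f n h := by
      intro d
      rcases eq_or_ne (π.prob a n hn h d) 0 with h0 | h0
      · simp [h0]
      gcongr
      have hfs : ∀ z, f (n + 1) (Fin.snoc (α := fun _ => I.Outcome) h (d, z)) =
          ∑ s, ((h s).2.2 : ℝ≥0∞) + ((z.2 : ℝ≥0∞) + greedyAdds p B (I.T - (n + 1))
            (fun k => I.consumed h k + if z.1 k = true then 1 else 0)) := by
        intro z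
        simp only [f]
        rw [sum_snoc fun o : I.Outcome => (o.2.2 : ℝ≥0∞), add_assoc]
        simp_rw [consumed_snoc]
      have hmz : Measurable fun z : (Fin I.K → Bool) × ℝ≥0 => (z.2 : ℝ≥0∞) +
          greedyAdds p B (I.T - (n + 1))
            (fun k => I.consumed h k + if z.1 k = true then 1 else 0) :=
        measurable_snd.coe_nnreal_ennreal.add ((measurable_of_countable fun c : Fin I.K → Bool =>
          greedyAdds p B (I.T - (n + 1)) fun k =>
            I.consumed h k + if c k = true then 1 else 0).comp measurable_fst)
      rw [lintegral_congr hfs, lintegral_add_left measurable_const, lintegral_const, measure_univ,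
        mul_one]
      simp only [f]
      gcongr
      rcases d with _ | e
      · change ∫⁻ z, _ ∂(Measure.dirac (fun _ => false, 0)) ≤ _
        rw [lintegral_dirac' _ hmz, hTn]
        simpa using greedyAdds_le_succ (I.T - (n + 1)) fun k => I.consumed h k
      -- As p > 0, every resource lies in the support, so safety requires a unit of each.
      · have hsafe : ∀ k, I.consumed h k + 1 ≤ B := by
          intro k
          rw [← hbudget k]
          refine π.safe a n hn h e h0 k (mem_support.2 ?_)
          rw [hcost]
          exact_mod_cast hp0
        change ∫⁻ z, _ ∂I.law e ≤ _
        rw [hlaw e _ hmz, hTn, ← one_add_sum_availProb hsafe]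
        dsimp only
        rw [lintegral_add_left measurable_const, lintegral_greedyAdds hp]
        simp
    refine (Finset.sum_le_sum fun d _ => hd d).trans_eq ?_
    rw [← Finset.sum_mul, ← ENNReal.ofReal_sum_of_nonneg fun d _ => π.nonneg a n hn h d,
      π.sum_one, ENNReal.ofReal_one, one_mul]
  refine (I.arrivalAvg_mono (g := fun _ => greedyAdds p B I.T (fun _ : Fin I.K => 0))
    fun a => ?_).trans_eq (I.arrivalAvg_const _)
  refine (lintegral_mono fun h => ?_).trans
    ((π.lintegral_historyLaw_le a hf (hstep a) I.T le_rfl).trans (le_of_eq ?_))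
  · exact le_self_add
  · simp [f, consumed]

theorem value_iidInstance_le (hp0 : 0 < p) (π : (iidInstance K B T hB p hp).Policy) :
    π.value ≤ greedyAdds p B T (fun _ : Fin K => 0) :=
  value_le_greedyAdds hp0 (fun _ => rfl) (meanCost_iidInstance hB hp)
    (fun _ _ hg => lintegral_iidLaw K p hg) hp π

end

/-- The hard instance with p = B/T, the largest consumption probability for which all T rounds fit
into the LP budget. -/
theorem mul_le_sum_of_mem_onlineRatios {Δ B T : ℕ} (hΔ : 0 < Δ) (hB : 0 < B) (hBT : B ≤ T) {ρ : ℝ}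
    (hρ : ρ ∈ onlineRatios Δ B T) :
    ρ ≤ (∑ t ∈ Finset.range T, (1 - binomTail (B / T) t B) ^ Δ) / T := by
  obtain ⟨⟨hρ0, hρ1⟩, ALG, -, hALG⟩ := hρ
  have hTn : 0 < T := hB.trans_le hBT
  have hT : (0 : ℝ) < T := by exact_mod_cast hTn
  let p : ℝ≥0 := B / T
  have hpc : (p : ℝ) = B / T := by simp [p]
  have hp0 : 0 < p := by
    have : (0 : ℝ≥0) < B := by exact_mod_cast hB
    have : (0 : ℝ≥0) < T := by exact_mod_cast hTn
    positivity
  have hp1 : p ≤ 1 := by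
    rw [← NNReal.coe_le_coe, hpc, NNReal.coe_one, div_le_one hT]
    exact_mod_cast hBT
  have hp1' : (p : ℝ) ≤ 1 := by exact_mod_cast hp1
  have hnn : ∀ t, 0 ≤ 1 - binomTail p t B := fun t => by
    linarith [binomTail_le_one (NNReal.coe_nonneg p) hp1' t B]
  have h1 := hALG _ (inClass_iidInstance (T := T) hB hp1 hΔ)
  have h2 := h1.trans (value_iidInstance_le hB hp1 hp0 _)
  have h3 := le_lpValue_iidInstance (K := Δ) (T := T) hB hp1 (by
    rw [hpc, div_mul_cancel₀ _ hT.ne'])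
  have h4 : ENNReal.ofReal (ρ * T) ≤
      ENNReal.ofReal (∑ t ∈ Finset.range T, (1 - binomTail p t B) ^ Δ) := by
    rw [ENNReal.ofReal_mul hρ0, ENNReal.ofReal_natCast,
      ENNReal.ofReal_sum_of_nonneg fun t _ => pow_nonneg (hnn t) _]
    refine le_trans (by gcongr) (h2.trans_eq ?_)
    refine Finset.sum_congr rfl fun t _ => ?_
    rw [ENNReal.ofReal_pow (hnn t)]
    simp [availProb]
  rw [ENNReal.ofReal_le_ofReal_iff (Finset.sum_nonneg fun t _ => pow_nonneg (hnn t) _), hpc] at h4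
  rwa [le_div_iff₀ hT]

end MBOSM

/-! ### Largest and best competitive ratios -/

namespace MBOSM

variable (Δ B T : ℕ)

theorem zero_mem_sampRatios : (0 : ℝ) ∈ sampRatios Δ B T :=
  ⟨⟨le_rfl, zero_le_one⟩, fun I _ x hx => by simp⟩

/-- Each instance imposes a closed condition on ρ, because the LP value is finite. Compactness turns
the supremum into a maximum. -/
theorem isCompact_sampRatios : IsCompact (sampRatios Δ B T) := by
  refine isCompact_Icc.of_isClosed_subset ?_ fun ρ hρ => hρ.1
  have : sampRatios Δ B T = Set.Icc 0 1 ∩ ⋂ (I : MBOSM) (_ : InClass Δ B T I) (x : I.Edge → ℝ)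
      (hx : I.LPOptimal x), {ρ | ENNReal.ofReal ρ * I.lpValue ≤
        (I.samp 1 ⟨zero_le_one, le_rfl⟩ x hx.1).value} := by
    ext ρ
    simp [sampRatios]
  rw [this]
  refine isClosed_Icc.inter (isClosed_iInter fun I => isClosed_iInter fun _ =>
    isClosed_iInter fun x => isClosed_iInter fun hx => isClosed_le ?_ continuous_const)
  exact (ENNReal.continuous_mul_const I.lpValue_ne_top).comp ENNReal.continuous_ofReal

/-- The largest competitive ratio of the sampling algorithm. -/
noncomputable def sampRatio : ℝ := sSup (sampRatios Δ B T)

/-- The best competitive ratio of all online algorithms. -/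
noncomputable def onlineRatio : ℝ := sSup (onlineRatios Δ B T)

theorem isGreatest_sampRatio : IsGreatest (sampRatios Δ B T) (sampRatio Δ B T) :=
  (isCompact_sampRatios Δ B T).isGreatest_sSup ⟨0, zero_mem_sampRatios Δ B T⟩

theorem sampRatios_subset_onlineRatios : sampRatios Δ B T ⊆ onlineRatios Δ B T := by
  rintro ρ ⟨hρ, h⟩
  choose x hx using exists_lpOptimal
  exact ⟨hρ, fun I => I.samp 1 ⟨zero_le_one, le_rfl⟩ (x I) (hx I).1,
    fun I => I.samp_isOnline _ _ _ _, fun I hI => h I hI (x I) (hx I)⟩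

/-- The LP value dominates the clairvoyant optimum. -/
theorem sampRatios_subset_sampOptRatios : sampRatios Δ B T ⊆ sampOptRatios Δ B T := by
  rintro ρ ⟨hρ, h⟩
  refine ⟨hρ, fun I hI x hx => le_trans ?_ (h I hI x hx)⟩
  gcongr
  exact I.optValue_le_lpValue

theorem isLUB_onlineRatio : IsLUB (onlineRatios Δ B T) (onlineRatio Δ B T) :=
  isLUB_csSup ⟨0, sampRatios_subset_onlineRatios Δ B T (zero_mem_sampRatios Δ B T)⟩
    ⟨1, fun _ hρ => hρ.1.2⟩

theorem sampRatio_le_onlineRatio : sampRatio Δ B T ≤ onlineRatio Δ B T :=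
  (isLUB_onlineRatio Δ B T).1
    (sampRatios_subset_onlineRatios Δ B T (isGreatest_sampRatio Δ B T).1)

variable {Δ B T}

theorem onlineRatio_le (hΔ : 0 < Δ) (hB : 0 < B) (hBT : B ≤ T) : onlineRatio Δ B T ≤
    (∑ t ∈ Finset.range T, (1 - binomTail (B / T) t B) ^ Δ) / T :=
  (isLUB_onlineRatio Δ B T).2 fun _ hρ => mul_le_sum_of_mem_onlineRatios hΔ hB hBT hρ

theorem onlineRatio_one_le (hB : 0 < B) (hBT : B ≤ T) :
    onlineRatio 1 B T ≤ 1 - binomLoss B T := by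
  have hT : (T : ℝ) ≠ 0 := by
    have : 0 < T := hB.trans_le hBT
    positivity
  refine (onlineRatio_le one_pos hB hBT).trans_eq ?_
  simp only [pow_one, Finset.sum_sub_distrib, Finset.sum_const, Finset.card_range, nsmul_eq_mul,
    mul_one, sub_div, div_self hT, binomLoss]

end MBOSM

/-! ### Squeezing the two ratios -/

/-- Here ε is the relative error of the loss of the sampling algorithm and δ that of the best online
ratio. As δ ≤ ε, the hard instance need only bound δ from below and the analysis of the algorithm
need only bound ε from above. -/
theorem tendsto_zero_of_sandwich {α : Type*} {l : Filter α} {δ ε u : α → ℝ}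
    (h1 : ∀ η > 0, ∀ᶠ q in l, -η ≤ δ q) (h2 : ∀ᶠ q in l, δ q ≤ ε q) (h3 : ∀ᶠ q in l, ε q ≤ u q)
    (hu : Tendsto u l (𝓝 0)) : Tendsto ε l (𝓝 0) ∧ Tendsto δ l (𝓝 0) := by
  have hlow : ∀ b < 0, ∀ᶠ q in l, b < δ q := fun b hb => by
    filter_upwards [h1 (-b / 2) (by linarith)] with q hq
    linarith
  constructor
  · refine tendsto_order.2 ⟨fun b hb => ?_, fun b hb => ?_⟩
    · filter_upwards [hlow b hb, h2] with q h h'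
      linarith
    · filter_upwards [h3, hu.eventually_lt_const hb] with q h h'
      linarith
  · refine tendsto_order.2 ⟨hlow, fun b hb => ?_⟩
    filter_upwards [h2, h3, hu.eventually_lt_const hb] with q h h' h''
    linarith

namespace MBOSM

theorem eventually_regimeOne : ∀ᶠ q in regimeOne, 0 < q.1 ∧ q.1 ≤ q.2 := by
  filter_upwards [tendsto_regimeOne_fst.eventually_gt_atTop 0,
    tendsto_regimeOne_ratio.eventually_ge_atTop 1] with q h1 h2
  rw [one_le_div (by positivity)] at h2
  exact ⟨h1, by exact_mod_cast h2⟩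

theorem tendsto_ratios_regimeOne :
    Tendsto (fun q : ℕ × ℕ => √(2 * Real.pi * q.1) * (1 - sampRatio 1 q.1 q.2) - 1)
      regimeOne (𝓝 0) ∧
    Tendsto (fun q : ℕ × ℕ => √(2 * Real.pi * q.1) * (1 - onlineRatio 1 q.1 q.2) - 1)
      regimeOne (𝓝 0) := by
  have hT : Tendsto (fun q : ℕ × ℕ => q.2) regimeOne atTop :=
    tendsto_atTop_mono' _ (eventually_regimeOne.mono fun q hq => hq.2) tendsto_regimeOne_fst
  have hpi : √Real.pi ≠ 0 := (Real.sqrt_pos.2 Real.pi_pos).ne'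
  have hs : Tendsto (fun q : ℕ × ℕ => Stirling.stirlingSeq q.2 / √Real.pi) regimeOne (𝓝 1) := by
    have := (Stirling.tendsto_stirlingSeq_sqrt_pi.comp hT).div_const (√Real.pi)
    rwa [div_self hpi] at this
  have hscale : Tendsto (fun q : ℕ × ℕ => 1 / √(2 * Real.pi * q.1)) regimeOne (𝓝 0) := by
    refine Tendsto.const_div_atTop (Real.tendsto_sqrt_atTop.comp ?_) 1
    exact (tendsto_natCast_atTop_atTop.comp tendsto_regimeOne_fst).const_mul_atTop
      (by positivity : 0 < 2 * Real.pi)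
  have hle : ∀ᶠ q in regimeOne,
      1 / √(2 * Real.pi * q.1) * (Stirling.stirlingSeq q.2 / √Real.pi) ≤ 1 := by
    have := hscale.mul hs
    rw [zero_mul] at this
    exact this.eventually_le_const one_pos
  refine tendsto_zero_of_sandwich (u := fun q => Stirling.stirlingSeq q.2 / √Real.pi - 1)
    (fun η hη => ?_) ?_ ?_ (by simpa using hs.sub_const 1)
  · filter_upwards [eventually_regimeOne,
      tendsto_sqrt_mul_binomLoss.eventually_const_lt (by linarith : 1 - η < 1)] with q h1 h2
    have := mul_le_mul_of_nonneg_left (onlineRatio_one_le h1.1 h1.2)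
      (Real.sqrt_nonneg (2 * Real.pi * q.1))
    linarith
  · filter_upwards with q
    have := sampRatio_le_onlineRatio 1 q.1 q.2
    gcongr
  · filter_upwards [eventually_regimeOne, hle] with q h1 h2
    have hB : (0 : ℝ) < q.1 := by exact_mod_cast h1.1
    have h3 := (isGreatest_sampRatio 1 q.1 q.2).2
      (mem_sampRatios_one h1.1 (h1.1.trans_le h1.2) (sub_nonneg.2 h2))
    have hpos : 0 < √(2 * Real.pi * q.1) := Real.sqrt_pos.2 (by positivity)
    have h4 := mul_le_mul_of_nonneg_left h3 hpos.le
    rw [mul_sub, ← mul_assoc, mul_one_div_cancel hpos.ne'] at h4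
    linarith

theorem tendsto_ratios_regimeGeneral :
    Tendsto (fun q : ℕ × ℕ × ℕ => (1 - sampRatio q.1 q.2.1 q.2.2) / lossScale q - 1)
      regimeGeneral (𝓝 0) ∧
    Tendsto (fun q : ℕ × ℕ × ℕ => (1 - onlineRatio q.1 q.2.1 q.2.2) / lossScale q - 1)
      regimeGeneral (𝓝 0) := by
  have hΔ : ∀ᶠ q in regimeGeneral, 1 < q.1 := by
    filter_upwards [eventually_regimeGeneral] with q hq
    by_contra h
    -- With the convention ln 0 = 0, positivity of ln Δ excludes both 0 and 1.
    have h0 := hq.1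
    rcases (by omega : q.1 = 0 ∨ q.1 = 1) with h | h <;> simp [h] at h0
  have hu : Tendsto (fun q : ℕ × ℕ × ℕ => 2 * (1 / (q.2.2 * lossScale q)) +
      1 / (q.2.1 * lossScale q ^ 2)) regimeGeneral (𝓝 0) := by
    simpa using (tendsto_inv_horizon_mul_lossScale.const_mul 2).add
      (tendsto_budget_mul_lossScale.const_div_atTop 1)
  have hle : ∀ᶠ q in regimeGeneral, lossScale q * (1 + (2 * (1 / (q.2.2 * lossScale q)) +
      1 / (q.2.1 * lossScale q ^ 2))) ≤ 1 := by
    have := tendsto_lossScale.mul (hu.const_add 1)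
    rw [zero_mul] at this
    exact this.eventually_le_const one_pos
  refine tendsto_zero_of_sandwich (fun η hη => ?_) ?_ ?_ hu
  · have hη' : 0 < min (η / 3) (1 / 2) := by positivity
    filter_upwards [eventually_regimeGeneral, hΔ, lossScale_pos,
      eventually_sum_one_sub_binomTail_pow_le hη' ((min_le_right _ _).trans_lt (by norm_num))]
      with q h1 h2 h3 h4
    have h5 := (onlineRatio_le (by omega) (by omega) (by omega)).trans h4
    have h6 : 1 - 3 * min (η / 3) (1 / 2) ≤ (1 - onlineRatio q.1 q.2.1 q.2.2) / lossScale q := by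
      rw [le_div_iff₀ h3]
      linarith
    linarith [min_le_left (η / 3) (1 / 2)]
  · filter_upwards [lossScale_pos] with q hq
    have := sampRatio_le_onlineRatio q.1 q.2.1 q.2.2
    gcongr
  · filter_upwards [eventually_regimeGeneral, hΔ, lossScale_pos, hle] with q h1 h2 h3 h4
    have hB : (0 : ℝ) < q.2.1 := by exact_mod_cast (by omega : 0 < q.2.1)
    have hT : (0 : ℝ) < q.2.2 := by exact_mod_cast (by omega : 0 < q.2.2)
    have he : lossScale q * (1 + (2 * (1 / (q.2.2 * lossScale q)) +
        1 / (q.2.1 * lossScale q ^ 2))) =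
          lossScale q + 2 / q.2.2 + 1 / (q.2.1 * lossScale q) := by
      field_simp
      ring
    have h5 := (isGreatest_sampRatio q.1 q.2.1 q.2.2).2 (mem_sampRatios_general h2
      (by omega) (by omega) rfl (sub_nonneg.2 (he.symm.trans_le h4)))
    change 1 - (lossScale q + 2 / q.2.2 + 1 / (q.2.1 * lossScale q)) ≤ _ at h5
    rw [← he] at h5
    rw [sub_le_iff_le_add, div_le_iff₀ h3]
    linarith

end MBOSM

theorem theorem4 :
    -- sparsity one
    (∃ ε δ : ℕ × ℕ → ℝ, Tendsto ε MBOSM.regimeOne (𝓝 0) ∧ Tendsto δ MBOSM.regimeOne (𝓝 0) ∧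
      ∀ᶠ q in MBOSM.regimeOne,
        -- the competitive ratio of the sampling algorithm
        IsGreatest (MBOSM.sampRatios 1 q.1 q.2)
          (1 - 1 / Real.sqrt (2 * Real.pi * q.1) * (1 + ε q)) ∧
        1 - 1 / Real.sqrt (2 * Real.pi * q.1) * (1 + ε q) ∈ MBOSM.sampOptRatios 1 q.1 q.2 ∧
        -- the best competitive ratio of all online algorithms
        IsLUB (MBOSM.onlineRatios 1 q.1 q.2)
          (1 - 1 / Real.sqrt (2 * Real.pi * q.1) * (1 + δ q))) ∧
    -- general sparsity
    (∃ κ : ℝ, Real.sqrt 2 ≤ κ ∧ κ ≤ 2 * Real.sqrt 2 ∧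
      ∃ ε δ : ℕ × ℕ × ℕ → ℝ, Tendsto ε MBOSM.regimeGeneral (𝓝 0) ∧
        Tendsto δ MBOSM.regimeGeneral (𝓝 0) ∧
        ∀ᶠ q in MBOSM.regimeGeneral,
          IsGreatest (MBOSM.sampRatios q.1 q.2.1 q.2.2)
            (1 - κ * Real.sqrt (Real.log q.1 / q.2.1) * (1 + ε q)) ∧
          1 - κ * Real.sqrt (Real.log q.1 / q.2.1) * (1 + ε q) ∈
            MBOSM.sampOptRatios q.1 q.2.1 q.2.2 ∧
          IsLUB (MBOSM.onlineRatios q.1 q.2.1 q.2.2)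
            (1 - κ * Real.sqrt (Real.log q.1 / q.2.1) * (1 + δ q))) := by
  -- The error terms are the exact relative errors of the losses, so the claimed expressions equal
  -- the extremal ratios identically; κ is √2.
  refine ⟨⟨_, _, MBOSM.tendsto_ratios_regimeOne.1, MBOSM.tendsto_ratios_regimeOne.2, ?_⟩,
    √2, le_rfl, by linarith [Real.sqrt_nonneg 2], _, _, MBOSM.tendsto_ratios_regimeGeneral.1,
    MBOSM.tendsto_ratios_regimeGeneral.2, ?_⟩
  · filter_upwards [MBOSM.eventually_regimeOne] with q hq
    have hB : (0 : ℝ) < q.1 := by exact_mod_cast hq.1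
    have hpos : 0 < √(2 * Real.pi * q.1) := Real.sqrt_pos.2 (by positivity)
    have hval : ∀ r : ℝ,
        1 - 1 / √(2 * Real.pi * q.1) * (1 + (√(2 * Real.pi * q.1) * (1 - r) - 1)) = r := by
      intro r
      field_simp
      ring
    rw [hval, hval]
    exact ⟨MBOSM.isGreatest_sampRatio _ _ _, MBOSM.sampRatios_subset_sampOptRatios _ _ _
      (MBOSM.isGreatest_sampRatio _ _ _).1, MBOSM.isLUB_onlineRatio _ _ _⟩
  · filter_upwards [MBOSM.lossScale_pos] with q hq
    have hs : √2 * √(Real.log q.1 / q.2.1) = MBOSM.lossScale q := by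
      rw [MBOSM.lossScale, mul_div_assoc, Real.sqrt_mul (by norm_num)]
    have hval : ∀ r : ℝ, 1 - MBOSM.lossScale q * (1 + ((1 - r) / MBOSM.lossScale q - 1)) = r := by
      intro r
      field_simp
      ring
    rw [hs, hval, hval]
    exact ⟨MBOSM.isGreatest_sampRatio _ _ _, MBOSM.sampRatios_subset_sampOptRatios _ _ _
      (MBOSM.isGreatest_sampRatio _ _ _).1, MBOSM.isLUB_onlineRatio _ _ _⟩
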